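/- **Model.** A network is a connected simple graph on $n$ nodes with pairwise distinct identifiers from $\{0,\dots,n^k-1\}$, where $k$ is a constant. In the deterministic Congest model with message size $b$, all nodes run the same deterministic algorithm in synchronous rounds. Initially a node knows its own identifier, the identifiers of its neighbors, its input, and the global parameters ($n$, $k$, $F$, $\ell$). In each round it sends to each neighbor a (possibly different) message of at most $b$ bits, receives the messages of its neighbors, and updates its state; local computation is unrestricted. **Resilient labeling scheme.** A labeling scheme from $\ell$ bits to $\ell'$ bits consists of (i) an oracle, which maps every network with a labeling $\varphi:V\to\{0,1\}^{\ell}$ to a new labeling $\psi:V\to\{0,1\}^{\ell'}$, and (ii) a deterministic Congest algorithm, in which the input of a node $v$ is either $\psi(v)$ or a symbol indicating that $\psi(v)$ is erased. It tolerates $F$ label erasures within $T$ rounds on $n$-node networks if, for every $n$-node network, every $\varphi$, and every set of at most $F$ nodes whose new labels are erased, every node $v$ (erased or not) outputs $\varphi(v)$ after $T$ rounds. **Theorem.** There are a constant $A\in\mathbb N$, a function $B:\mathbb N\to\mathbb N$ and constants $C,R$ with $B(F)\le C\log_2 F$ for all $F$ (where $\log_2 0$ is read as $0$), such that for every $k$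 there is a constant $\beta$ with the following property. For all $n,F,\ell\in\mathbb N$ with $n>80F$ there is a labeling scheme from $\ell$ bits to $\ell'=A\ell+B(F)$ bits, whose algorithm uses messages of at most $\beta\lfloor\log_2 n\rfloor$ bits, that tolerates $F$ label erasures on $n$-node networks with identifiers in $\{0,\dots,n^k-1\}$ within $$T\;\le\;R\left(F+\frac{\ell\cdot F}{\log_2 n}\right)$$ rounds (for $n=1$, where necessarily $F=0$, the bound is read as $0$). -/

import Mathlib

/-- Bit strings of length `k`. -/
abbrev BitString (k : ℕ) : Type := Fin k → Bool

/-- A network: a connected graph whose nodes carry unique identifiers. -/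
structure Network (V : Type) where
  graph : SimpleGraph V
  connected : graph.Connected
  id : V → ℕ
  id_injective : Function.Injective id

/-- A deterministic synchronous message-passing algorithm with node inputs in `I` and node outputs
in `O`, in which a message consists of at most `b` bits. All nodes run the same algorithm; a node
initially knows its own identifier, the identifiers of its neighbors, and its input. Local
computation is unrestricted. -/
structure CongestAlgorithm (b : ℕ) (I O : Type) where
  /-- the local states of a node -/
  State : Type
  /-- initial state, from the own identifier, the set of identifiers of the neighbors, the input -/
  init : ℕ → Set ℕ → I → State
  /-- the message that a node in the given state sends to its neighbor with the given identifier -/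
  send : State → ℕ → List Bool
  /-- the new state, from the old one and the messages received in this round; the message of the
  neighbor with identifier `i` is the value at `i` -/
  receive : State → (ℕ → List Bool) → State
  /-- the output that a node in the given state produces -/
  output : State → O
  /-- every message fits into the bandwidth -/
  send_length_le : ∀ s i, (send s i).length ≤ b

namespace CongestAlgorithm

variable {b : ℕ} {I O V : Type}

/-- The messages that arrive at `v` when the nodes are in the states `s`: the value at the
identifier of a neighbor `u` of `v` is the message from `u` to `v`, and the value at a number that
is not the identifier of a neighbor is the empty string. -/
noncomputable def inbox (A : CongestAlgorithm b I O) (N : Network V) (s : V → A.State) (v : V) :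
    ℕ → List Bool :=
  Function.extend (fun u : N.graph.neighborSet v => N.id u)
    (fun u : N.graph.neighborSet v => A.send (s u) (N.id v)) (fun _ => [])

/-- The states of all nodes after `t` rounds, on the network `N` with inputs `x`. -/
noncomputable def stateAfter (A : CongestAlgorithm b I O) (N : Network V) (x : V → I) :
    ℕ → V → A.State
  | 0 => fun v => A.init (N.id v) (N.id '' N.graph.neighborSet v) (x v)
  | t + 1 => fun v => A.receive (A.stateAfter N x t v) (A.inbox N (A.stateAfter N x t) v)

/-- The output of node `v` after `t` rounds, on the network `N` with inputs `x`. -/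
noncomputable def outputAfter (A : CongestAlgorithm b I O) (N : Network V) (x : V → I)
    (t : ℕ) (v : V) : O :=
  A.output (A.stateAfter N x t v)

end CongestAlgorithm

/-- The two parts of a labeling scheme that turns `ℓ`-bit labels into `ℓ'`-bit labels: an oracle,
which sees the whole network and the original labeling, and a distributed algorithm with `b`-bit
messages, in which every node receives its new label, or `none` if that label is erased. -/
structure LabelingScheme (ℓ ℓ' b : ℕ) where
  oracle : (V : Type) → Network V → (V → BitString ℓ) → (V → BitString ℓ')
  algorithm : CongestAlgorithm b (Option (BitString ℓ')) (BitString ℓ)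

/-- On every connected `n`-node network with unique identifiers in `{0, …, n ^ k - 1}`, for every
original labeling and every set of at most `F` erasures, every node (with or without an erased
label) outputs its original label after `T` rounds. -/
def LabelingScheme.IsResilient {ℓ ℓ' b : ℕ} (S : LabelingScheme ℓ ℓ' b) (n k F T : ℕ) : Prop :=
  ∀ (V : Type) [Fintype V] [DecidableEq V] (N : Network V), Fintype.card V = n →
    (∀ v, N.id v < n ^ k) →
    ∀ (φ : V → BitString ℓ) (erased : Finset V), erased.card ≤ F →
      ∀ v, S.algorithm.outputAfter N
        (fun u => if u ∈ erased then none else some (S.oracle V N φ u)) T v = φ v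

/-! The nodes are split into groups of at least `2F` and at most `6F` nodes, each held together by
edges of a forest, with no edge serving two groups. Besides its old label, a node stores a check
symbol of a polynomial code on its group. At most half of a group is erased, so the surviving
symbols determine all labels of the group (`exists_check`, `decodeGroup_eq`). Pipelined flooding
(`flooding`, `floodState_eq`) brings them to every member in `O(F)` steps, each costing `O(1 + ℓ /
log n)` rounds.

The difficulty is that the nodes must find the groups while `F` labels are missing. The forest is a
breadth-first search forest rooted at the nodes whose identifier is smallest within `4F` hops; roots
recognize themselves without labels, and every tree has more than `2F` nodes (`lt_ncard_tree`).
Groups are formed from the leaves upwards: with `s = 2F`, a node packs the open groups of its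
children into closed chunks of weight between `s` and `2s` and hands the rest, together with itself,
to its parent. What remains at a root may be too small, so it is merged with one chunk touching it.

Two numbers of `O(log F)` bits in each label describe this structure: the distance to the nearest
root modulo `4F + 3`, and the size of the open group handed upwards. Erased values heal in `F`
steps, because every step repairs an incorrect distance nearest to the roots, respectively an
unknown weight farthest from them (`distEst_eq`, `weightEst_eq`). Chunkings and check functions are
fixed choices depending only on their arguments, so the oracle and all nodes agree on them. -/

/-! ### Composition of message-passing algorithms. -/

/-- The pairs consisting of the identifier of a neighbor `u` of `v` and the value `f u`. -/
def Network.nbrData {V M : Type} (N : Network V) (v : V) (f : V → M) : Set (ℕ × M) :=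
  {p | ∃ u, N.graph.Adj v u ∧ p = (N.id u, f u)}

/-- On a family of networks `N i` with inputs `x i`, every node `v` can compute the value `X i v`
within exactly `T` rounds with `b`-bit messages. -/
def Known {J : Type 1} {I α : Type} {V : J → Type} (b : ℕ) (N : ∀ i, Network (V i))
    (x : ∀ i, V i → I) (T : ℕ) (X : ∀ i, V i → α) : Prop :=
  ∃ A : CongestAlgorithm b I α, ∀ i v, A.outputAfter (N i) (x i) T v = X i v

namespace Known

variable {J : Type 1} {I α γ M : Type} {V : J → Type} {b : ℕ} {N : ∀ i, Network (V i)}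
  {x : ∀ i, V i → I} {T : ℕ} {X : ∀ i, V i → α}

theorem congr {X' : ∀ i, V i → α} (h : Known b N x T X) (e : ∀ i v, X i v = X' i v) :
    Known b N x T X' := by
  obtain ⟨A, hA⟩ := h
  exact ⟨A, fun i v => (hA i v).trans (e i v)⟩

theorem map (h : Known b N x T X) (f : α → γ) : Known b N x T (fun i v => f (X i v)) := by
  obtain ⟨A, hA⟩ := h
  refine ⟨⟨A.State, A.init, A.send, A.receive, f ∘ A.output, A.send_length_le⟩, fun i v => ?_⟩
  have key : ∀ t, CongestAlgorithm.stateAfter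
      ⟨A.State, A.init, A.send, A.receive, f ∘ A.output, A.send_length_le⟩ (N i) (x i) t =
      A.stateAfter (N i) (x i) t := by
    intro t
    induction t with
    | zero => rfl
    | succ t ih =>
      funext v
      simp only [CongestAlgorithm.stateAfter, ih]
      rfl
  simp only [CongestAlgorithm.outputAfter, key, Function.comp]
  exact congrArg f (hA i v)

theorem init (b : ℕ) (N : ∀ i, Network (V i)) (x : ∀ i, V i → I) :
    Known b N x 0 (fun i v => ((N i).id v, x i v)) :=
  ⟨⟨ℕ × I, fun a _ y => (a, y), fun _ _ => [], fun s _ => s, id, by simp⟩, fun _ _ => rfl⟩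

open Classical in
/-- The algorithm that runs `A` for `T` rounds and then sends the messages `f` of its outputs. -/
noncomputable def extendAlgorithm (A : CongestAlgorithm b I α) (T : ℕ) (f : α → ℕ → List Bool)
    (hf : ∀ a j, (f a j).length ≤ b) : CongestAlgorithm b I (α × Set (ℕ × List Bool)) where
  State := ℕ × A.State × Set ℕ × Set (ℕ × List Bool)
  init a nb y := (0, A.init a nb y, nb, ∅)
  send s j := if s.1 < T then A.send s.2.1 j else f (A.output s.2.1) j
  receive s r := if s.1 < T then (s.1 + 1, A.receive s.2.1 r, s.2.2.1, s.2.2.2)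
    else (s.1 + 1, s.2.1, s.2.2.1, {p | p.1 ∈ s.2.2.1 ∧ p.2 = r p.1})
  output s := (A.output s.2.1, s.2.2.2)
  send_length_le s j := by
    split
    · exact A.send_length_le _ _
    · exact hf _ _

theorem exchange_bits (h : Known b N x T X) (f : α → ℕ → List Bool)
    (hf : ∀ a j, (f a j).length ≤ b) :
    Known b N x (T + 1)
      (fun i v => (X i v, (N i).nbrData v fun u => f (X i u) ((N i).id v))) := by
  classical
  obtain ⟨A, hA⟩ := h
  refine ⟨extendAlgorithm A T f hf, fun i v => ?_⟩
  -- Through round `T` the extension runs in lockstep with `A`, with the set of final messages still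
  -- empty.
  have key : ∀ t, t ≤ T → ∀ v, (extendAlgorithm A T f hf).stateAfter (N i) (x i) t v =
      (t, A.stateAfter (N i) (x i) t v, (N i).id '' (N i).graph.neighborSet v, ∅) := by
    intro t
    induction t with
    | zero => intro _ v; rfl
    | succ t ih =>
      intro ht v
      have ht' : t < T := by omega
      have e1 := ih ht'.le
      have e2 : (extendAlgorithm A T f hf).inbox (N i)
          ((extendAlgorithm A T f hf).stateAfter (N i) (x i) t) v =
          A.inbox (N i) (A.stateAfter (N i) (x i) t) v := by
        unfold CongestAlgorithm.inbox
        congr 1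
        funext u
        rw [e1]
        simp [extendAlgorithm, ht']
      simp only [CongestAlgorithm.stateAfter]
      rw [e2, e1]
      simp [extendAlgorithm, ht']
  have e1 := key T le_rfl
  simp only [CongestAlgorithm.outputAfter, CongestAlgorithm.stateAfter]
  rw [e1]
  have e3 : ∀ w, A.output (A.stateAfter (N i) (x i) T w) = X i w := hA i
  simp only [extendAlgorithm, lt_irrefl, if_false, e3, Prod.mk.injEq, true_and]
  ext ⟨j, l⟩
  have inj : Function.Injective (fun u : (N i).graph.neighborSet v => (N i).id u) :=
    fun a c hac => Subtype.ext ((N i).id_injective hac)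
  have hin : ∀ u : (N i).graph.neighborSet v,
      (extendAlgorithm A T f hf).inbox (N i)
        ((extendAlgorithm A T f hf).stateAfter (N i) (x i) T) v ((N i).id u) =
      f (X i u) ((N i).id v) := by
    intro u
    have := inj.extend_apply (fun u : (N i).graph.neighborSet v =>
      (extendAlgorithm A T f hf).send
        ((extendAlgorithm A T f hf).stateAfter (N i) (x i) T u) ((N i).id v)) (fun _ => []) u
    unfold CongestAlgorithm.inbox
    rw [this, e1]
    simp [extendAlgorithm, e3]
  constructor
  · rintro ⟨⟨u, hu, rfl⟩, hl⟩
    exact ⟨u, hu, Prod.ext rfl (hl.trans (hin ⟨u, hu⟩))⟩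
  · rintro ⟨u, hu, he⟩
    obtain ⟨rfl, rfl⟩ := Prod.mk.inj he
    exact ⟨⟨u, hu, rfl⟩, (hin ⟨u, hu⟩).symm⟩

theorem exchange_chunks (h : Known b N x T X) (f : α → ℕ → ℕ → List Bool)
    (hf : ∀ a j t, (f a j t).length ≤ b) (m : ℕ) :
    Known b N x (T + (m + 1)) (fun i v => (X i v, (N i).nbrData v fun u =>
      fun t => if t < m + 1 then f (X i u) ((N i).id v) t else [])) := by
  induction m with
  | zero =>
    have := (h.exchange_bits (fun a j => f a j 0) (fun a j => hf _ _ _)).map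
      (fun a => (a.1, {p : ℕ × (ℕ → List Bool) | ∃ l, (p.1, l) ∈ a.2 ∧
        p.2 = fun t => if t = 0 then l else []}))
    refine this.congr fun i v => ?_
    simp only [Prod.mk.injEq, true_and]
    ext ⟨j, g⟩
    simp only [Network.nbrData, Set.mem_ofPred_eq, Prod.mk.injEq]
    have e : ∀ u, (fun t => if t = 0 then f (X i u) ((N i).id v) 0 else []) =
        fun t => if t < 0 + 1 then f (X i u) ((N i).id v) t else [] := by
      intro u
      funext t
      rcases t with _ | t <;> simp
    constructor
    · rintro ⟨l, ⟨u, hu, rfl, rfl⟩, rfl⟩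
      exact ⟨u, hu, rfl, e u⟩
    · rintro ⟨u, hu, rfl, rfl⟩
      exact ⟨_, ⟨u, hu, rfl, rfl⟩, (e u).symm⟩
  | succ m ih =>
    have := (ih.exchange_bits (fun a j => f a.1 j (m + 1)) (fun a j => hf _ _ _)).map
      (fun a => (a.1.1, {p : ℕ × (ℕ → List Bool) | ∃ g l, (p.1, g) ∈ a.1.2 ∧ (p.1, l) ∈ a.2 ∧
        p.2 = fun t => if t = m + 1 then l else g t}))
    refine this.congr fun i v => ?_
    simp only [Prod.mk.injEq, true_and]
    ext ⟨j, g⟩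
    simp only [Network.nbrData, Set.mem_ofPred_eq, Prod.mk.injEq]
    have e : ∀ u, (fun t => if t = m + 1 then f (X i u) ((N i).id v) (m + 1) else
        (if t < m + 1 then f (X i u) ((N i).id v) t else [])) =
        fun t => if t < m + 1 + 1 then f (X i u) ((N i).id v) t else [] := by
      intro u
      funext t
      rcases lt_trichotomy t (m + 1) with ht | rfl | ht
      · rw [if_neg ht.ne, if_pos ht, if_pos (by omega)]
      · simp
      · rw [if_neg ht.ne', if_neg (by omega), if_neg (by omega)]
    constructor
    · rintro ⟨g', l, ⟨u, hu, rfl, rfl⟩, ⟨u', hu', he, rfl⟩, rfl⟩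
      obtain rfl := (N i).id_injective he
      exact ⟨u, hu, rfl, e u⟩
    · rintro ⟨u, hu, rfl, rfl⟩
      exact ⟨_, _, ⟨u, hu, rfl, rfl⟩, ⟨u, hu, rfl, rfl⟩, (e u).symm⟩

/-- Messages from a set of at most `2 ^ (m * b)` elements can be exchanged in `m` rounds. -/
theorem exchange (h : Known b N x T X) {m : ℕ} (hm : 0 < m) (f : α → ℕ → M) {S : Set M}
    (hS : S.Finite) (hcard : S.ncard ≤ 2 ^ (m * b))
    (hf : ∀ i v u, (N i).graph.Adj v u → f (X i u) ((N i).id v) ∈ S) :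
    Known b N x (T + m)
      (fun i v => (X i v, (N i).nbrData v fun u => f (X i u) ((N i).id v))) := by
  -- An element of `S` is encoded as `m` blocks of `b` bits, one block per round.
  obtain ⟨enc, henc⟩ : ∃ enc : M → (Fin m → Fin b → Bool), S.InjOn enc := by
    have : S.encard ≤ (Set.univ : Set (Fin m → Fin b → Bool)).encard := by
      rw [← hS.cast_ncard_eq, ← Set.finite_univ.cast_ncard_eq, Set.ncard_univ]
      have e : Nat.card (Fin m → Fin b → Bool) = 2 ^ (m * b) := by
        simp [← pow_mul, mul_comm]
      rw [e]
      exact_mod_cast hcard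
    obtain ⟨g, _, hg⟩ := hS.exists_injOn_of_encard_le this
    exact ⟨g, hg⟩
  obtain ⟨m, rfl⟩ : ∃ m', m = m' + 1 := ⟨m - 1, by omega⟩
  let word : M → ℕ → List Bool := fun a t =>
    if ht : t < m + 1 then List.ofFn (enc a ⟨t, ht⟩) else []
  have hword : ∀ a t, (word a t).length ≤ b := by
    intro a t
    simp only [word]
    split <;> simp
  have hinj : ∀ a ∈ S, ∀ c ∈ S, word a = word c → a = c := by
    intro a ha c hc e
    refine henc ha hc ?_
    funext t
    have := congrFun e t
    simp only [word, t.2, dite_true] at this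
    exact List.ofFn_injective this
  have := (h.exchange_chunks (fun a j => word (f a j)) (fun _ _ _ => hword _ _) m).map
    (fun a => (a.1, {p : ℕ × M | p.2 ∈ S ∧ (p.1, word p.2) ∈ a.2}))
  refine this.congr fun i v => ?_
  have e : ∀ a, (fun t => if t < m + 1 then word a t else []) = word a := by
    intro a
    funext t
    by_cases ht : t < m + 1
    · rw [if_pos ht]
    · rw [if_neg ht]
      simp only [word, dif_neg ht]
  simp only [Prod.mk.injEq, true_and]
  ext ⟨j, a⟩
  simp only [Network.nbrData, Set.mem_ofPred_eq, Prod.mk.injEq]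
  constructor
  · rintro ⟨ha, u, hu, rfl, hw⟩
    exact ⟨u, hu, rfl, hinj _ ha _ (hf i v u hu) (hw.trans (e _))⟩
  · rintro ⟨u, hu, rfl, rfl⟩
    exact ⟨hf i v u hu, u, hu, rfl, (e _).symm⟩

theorem iterate {m : ℕ} (hm : 0 < m) (f : α → ℕ → M) {S : Set M}
    (hS : S.Finite) (hcard : S.ncard ≤ 2 ^ (m * b)) (step : α → Set (ℕ × M) → α)
    (Y : ℕ → ∀ i, V i → α) (h : Known b N x T (Y 0))
    (hf : ∀ t i v u, (N i).graph.Adj v u → f (Y t i u) ((N i).id v) ∈ S)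
    (hY : ∀ t i v, Y (t + 1) i v =
      step (Y t i v) ((N i).nbrData v fun u => f (Y t i u) ((N i).id v))) (t : ℕ) :
    Known b N x (T + m * t) (Y t) := by
  induction t with
  | zero => simpa using h
  | succ t ih =>
    have := (ih.exchange hm f hS hcard (hf t)).map (fun a => step a.1 a.2)
    rw [Nat.mul_succ, ← add_assoc]
    exact this.congr fun i v => (hY t i v).symm

end Known

/-- A decreasing sequence of sets of at most `F` elements that strictly decreases until it is empty
is empty at time `F`. -/
theorem eq_empty_of_strict_decrease {V : Type} {U : ℕ → Set V} {F : ℕ} (hfin : (U 0).Finite)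
    (h0 : (U 0).ncard ≤ F) (hmono : ∀ t < F, U (t + 1) ⊆ U t)
    (hstrict : ∀ t < F, (U t).Nonempty → ∃ v ∈ U t, v ∉ U (t + 1)) : U F = ∅ := by
  have key : ∀ t ≤ F, (U t).Finite ∧ (U t).ncard ≤ F - t := by
    intro t
    induction t with
    | zero => exact fun _ => ⟨hfin, h0⟩
    | succ t ih =>
      intro ht
      have ih := ih (by omega)
      have hf := ih.1.subset (hmono t ht)
      refine ⟨hf, ?_⟩
      rcases (U t).eq_empty_or_nonempty with he | hne
      · have : U (t + 1) = ∅ := Set.subset_empty_iff.1 (he ▸ hmono t ht)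
        simp [this]
      · obtain ⟨v, hv, hv'⟩ := hstrict t ht hne
        have : (U (t + 1)).ncard < (U t).ncard :=
          Set.ncard_lt_ncard ⟨hmono t ht, fun h => hv' (h hv)⟩ ih.1
        omega
  have := key F le_rfl
  rw [Nat.sub_self, Nat.le_zero, Set.ncard_eq_zero this.1] at this
  exact this.2

/-! ### Packing weighted items into chunks. -/

section Chunks

/-- `c` splits weighted items into chunks: chunk `0` has weight less than `s`, and every other
nonempty chunk has weight at least `s` and less than `2 * s`. -/
def IsChunking (s : ℕ) (A : Finset (ℕ × ℕ)) (c : ℕ × ℕ → ℕ) : Prop :=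
  (∑ a ∈ A with c a = 0, a.2) < s ∧
    ∀ j ≠ 0, (∃ a ∈ A, c a = j) →
      s ≤ (∑ a ∈ A with c a = j, a.2) ∧ (∑ a ∈ A with c a = j, a.2) < 2 * s

/-- Greedy insertion: an item joins chunk `0` as long as that stays below `s`. Otherwise the item
and chunk `0` together weigh at least `s` and less than `s + s`; they are closed as a new chunk, and
chunk `0` restarts empty. -/
theorem exists_isChunking {s : ℕ} (hs : 0 < s) (A : Finset (ℕ × ℕ)) (hA : ∀ a ∈ A, a.2 ≤ s) :
    ∃ c, IsChunking s A c := by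
  classical
  induction A using Finset.induction_on with
  | empty => exact ⟨fun _ => 0, by simpa, by simp⟩
  | insert x A hx ih =>
    obtain ⟨c, hc0, hc⟩ := ih fun a ha => hA a (Finset.mem_insert_of_mem ha)
    have hxs := hA x (Finset.mem_insert_self _ _)
    have hne : ∀ a ∈ A, a ≠ x := fun a ha e => hx (e ▸ ha)
    by_cases hlt : x.2 + ∑ a ∈ A with c a = 0, a.2 < s
    · refine ⟨Function.update c x 0, ?_, ?_⟩
      · rw [Finset.filter_insert, if_pos (by simp), Finset.sum_insert (by simp [hx])]
        rwa [Finset.filter_congr (q := fun a => c a = 0)]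
        intro a ha
        rw [Function.update_of_ne (hne a ha)]
      · rintro j hj ⟨a, ha, haj⟩
        rw [Finset.filter_insert, if_neg (by simpa using hj.symm),
          Finset.filter_congr (q := fun a => c a = j)]
        · refine hc j hj ?_
          rcases Finset.mem_insert.1 ha with rfl | ha
          · simp at haj
            exact absurd haj.symm hj
          · exact ⟨a, ha, by rwa [Function.update_of_ne (hne a ha)] at haj⟩
        · intro a ha
          rw [Function.update_of_ne (hne a ha)]
    -- An index above all indices in use, hence fresh and nonzero.
    · let k := (∑ a ∈ A, c a) + 1
      have hk : ∀ a ∈ A, c a ≠ k := fun a ha => by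
        have := Finset.single_le_sum (f := c) (fun _ _ => Nat.zero_le _) ha
        omega
      let c' : ℕ × ℕ → ℕ := fun a => if a = x then k else if c a = 0 then k else c a
      have h' : ∀ a ∈ A, c' a = if c a = 0 then k else c a := fun a ha => by
        simp [c', hne a ha]
      have hx' : c' x = k := by simp [c']
      refine ⟨c', ?_, ?_⟩
      · rw [Finset.filter_insert, if_neg (by simp [hx', k]), Finset.filter_false_of_mem]
        · simpa
        · intro a ha
          rw [h' a ha]
          split_ifs <;> simp_all [k]
      · rintro j hj ⟨a, ha, haj⟩
        by_cases hjk : j = k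
        · subst hjk
          rw [Finset.filter_insert, if_pos hx', Finset.sum_insert (by simp [hx]),
            Finset.filter_congr (q := fun a => c a = 0)]
          · omega
          · intro a ha
            rw [h' a ha]
            have := hk a ha
            split_ifs <;> simp_all
        · rw [Finset.filter_insert, if_neg (by rw [hx']; exact fun e => hjk e.symm),
            Finset.filter_congr (q := fun a => c a = j)]
          · refine hc j hj ?_
            rcases Finset.mem_insert.1 ha with rfl | ha
            · exact absurd (hx'.symm.trans haj).symm hjk
            · refine ⟨a, ha, ?_⟩
              rw [h' a ha] at haj
              split_ifs at haj with h0
              · exact absurd haj.symm hjk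
              · exact haj
          · intro a ha
            rw [h' a ha]
            split_ifs with h0
            · rw [h0]
              exact ⟨fun e => absurd e.symm hjk, fun e => absurd e.symm hj⟩
            · rfl

open Classical in
/-- A chunking of the given weighted items, chosen once and for all. -/
noncomputable def chunk (s : ℕ) (A : Finset (ℕ × ℕ)) : ℕ × ℕ → ℕ :=
  if h : ∃ c, IsChunking s A c then h.choose else fun _ => 0

theorem isChunking_chunk {s : ℕ} (hs : 0 < s) {A : Finset (ℕ × ℕ)} (hA : ∀ a ∈ A, a.2 ≤ s) :
    IsChunking s A (chunk s A) := by
  have h := exists_isChunking hs A hA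
  rw [chunk, dif_pos h]
  exact h.choose_spec

end Chunks

/-! ### Check symbols that survive the erasure of half of the positions. -/

section Code

open Polynomial in
/-- Every symbol gets a check symbol such that the symbols and check symbols at half of the
positions determine everything: the symbols are values of a polynomial, the check symbols are
further values of it. -/
theorem exists_check {K ι : Type} [Field K] [Fintype K] [Fintype ι]
    (hcard : 2 * Fintype.card ι ≤ Fintype.card K) :
    ∃ c : (ι → K) → ι → K, ∀ (x y : ι → K) (E : Finset ι),
      2 * E.card ≤ Fintype.card ι → (∀ i ∉ E, x i = y i ∧ c x i = c y i) → x = y := by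
  classical
  obtain ⟨g⟩ : Nonempty (ι × Bool ↪ K) := by
    apply Function.Embedding.nonempty_of_card_le
    simpa [mul_comm] using hcard
  let p : (ι → K) → K[X] := fun x => Lagrange.interpolate Finset.univ (fun i => g (i, false)) x
  have hinj : Set.InjOn (fun i => g (i, false)) (Finset.univ : Finset ι) :=
    fun a _ b _ h => by simpa using g.injective h
  have hp : ∀ x i, (p x).eval (g (i, false)) = x i := fun x i =>
    Lagrange.eval_interpolate_at_node x hinj (Finset.mem_univ i)
  refine ⟨fun x i => (p x).eval (g (i, true)), fun x y E hE h => ?_⟩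
  suffices p x = p y by
    funext i
    rw [← hp x, ← hp y, this]
  have hdeg : ∀ x, (p x).degree < (Fintype.card ι : WithBot ℕ) := fun x => by
    have := Lagrange.degree_interpolate_lt x hinj
    rwa [Finset.card_univ] at this
  -- The surviving evaluation points, two for each position outside `E`. There are at least `card ι`
  -- of them, and both polynomials have degree below `card ι`.
  let Z : Finset K := ((Finset.univ \ E) ×ˢ (Finset.univ : Finset Bool)).map g
  have hZ : Fintype.card ι ≤ Z.card := by
    have := Finset.card_le_univ E
    rw [Finset.card_map, Finset.card_product, Finset.card_sdiff_of_subset (Finset.subset_univ _)]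
    simp only [Finset.card_univ, Fintype.card_bool]
    omega
  have hle : (Fintype.card ι : WithBot ℕ) ≤ Z.card := by exact_mod_cast hZ
  refine Polynomial.eq_of_degrees_lt_of_eval_finset_eq Z ((hdeg x).trans_le hle)
    ((hdeg y).trans_le hle) ?_
  intro z hz
  simp only [Z, Finset.mem_map, Finset.mem_product, Finset.mem_sdiff, Finset.mem_univ, true_and,
    and_true] at hz
  obtain ⟨⟨i, t⟩, hi, rfl⟩ := hz
  rcases t with _ | _
  · rw [hp, hp]
    exact (h i hi).1
  · exact (h i hi).2

/-- The defining property of a check function for the words on the set of positions `I`. -/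
def IsCheck {ℓ q : ℕ} (I : Set ℕ) (c : (ℕ → BitString ℓ) → ℕ → BitString q) : Prop :=
  ∀ (x y : ℕ → BitString ℓ) (E : Set ℕ), 2 * (E ∩ I).ncard ≤ I.ncard →
    (∀ i ∈ I, i ∉ E → x i = y i ∧ c x i = c y i) → ∀ i ∈ I, x i = y i

/-- `exists_check` over the field with `2 ^ q` elements: symbols embed because `ℓ ≤ q`, and the
bound on `I` provides two evaluation points per position. -/
theorem exists_isCheck {ℓ q : ℕ} (hℓ : ℓ ≤ q) (hq : q ≠ 0) {I : Set ℕ} (hI : I.Finite)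
    (hcard : 2 * I.ncard ≤ 2 ^ q) :
    ∃ c : (ℕ → BitString ℓ) → ℕ → BitString q, IsCheck I c := by
  classical
  have : Fact (Nat.Prime 2) := ⟨Nat.prime_two⟩
  let K := GaloisField 2 q
  have hK : Nat.card K = 2 ^ q := GaloisField.card 2 q hq
  have : Finite K := Nat.finite_of_card_ne_zero (by rw [hK]; positivity)
  have : Fintype K := Fintype.ofFinite K
  have hK' : Fintype.card K = 2 ^ q := by rw [← Nat.card_eq_fintype_card, hK]
  have : Fintype I := hI.fintype
  have hI' : Fintype.card I = I.ncard := by rw [← Nat.card_eq_fintype_card, Nat.card_coe_set_eq]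
  obtain ⟨emb⟩ : Nonempty (BitString ℓ ↪ K) := by
    apply Function.Embedding.nonempty_of_card_le
    rw [hK']
    simpa using Nat.pow_le_pow_right two_pos hℓ
  obtain ⟨out⟩ : Nonempty (K ↪ BitString q) := by
    apply Function.Embedding.nonempty_of_card_le
    rw [hK']
    simp
  obtain ⟨c, hc⟩ := exists_check (K := K) (ι := I) (by rw [hK', hI']; exact hcard)
  refine ⟨fun x i => if h : i ∈ I then out (c (fun j => emb (x j)) ⟨i, h⟩) else fun _ => false, ?_⟩
  intro x y E hE h i hi
  let E' : Finset I := Finset.univ.filter fun j => (j : ℕ) ∈ E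
  have hE' : E'.card = (E ∩ I).ncard := by
    rw [← Set.ncard_coe_finset, ← Set.ncard_image_of_injective _ Subtype.val_injective]
    congr 1
    ext j
    simp [E', and_comm]
  have := hc (fun j => emb (x j)) (fun j => emb (y j)) E' (by rw [hE', hI']; exact hE) ?_
  · exact emb.injective (congrFun this ⟨i, hi⟩)
  · intro j hj
    have hj' : (j : ℕ) ∉ E := by simpa [E'] using hj
    obtain ⟨h1, h2⟩ := h j j.2 hj'
    refine ⟨congrArg emb h1, ?_⟩
    simpa using h2

open Classical in
/-- A check function for the words on the set of positions `I`, chosen once and for all. -/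
noncomputable def check (ℓ q : ℕ) (I : Set ℕ) : (ℕ → BitString ℓ) → ℕ → BitString q :=
  if h : ∃ c : (ℕ → BitString ℓ) → ℕ → BitString q, IsCheck I c then h.choose
  else fun _ _ _ => false

theorem isCheck_check {ℓ q : ℕ} (hℓ : ℓ ≤ q) (hq : q ≠ 0) {I : Set ℕ} (hI : I.Finite)
    (hcard : 2 * I.ncard ≤ 2 ^ q) : IsCheck I (check ℓ q I) := by
  have h := exists_isCheck hℓ hq hI hcard
  rw [check, dif_pos h]
  exact h.choose_spec

end Code

/-! ### Pipelined flooding. -/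

section Flooding

/-- The tokens that have a chance to reach `w` within `i` hops along the relation `R`. -/
def reachTokens {W τ : Type} (R : W → W → Prop) (init : W → Set τ) : ℕ → W → Set τ
  | 0, w => init w
  | i + 1, w => reachTokens R init i w ∪ {a | ∃ z, R z w ∧ a ∈ reachTokens R init i z}

/-- If every vertex in every step forwards along every outgoing link some token not yet sent
along that link, then after `t` steps it has either at least `t - i + 1` tokens or all tokens
from within `i` hops. -/
theorem flooding {W τ : Type} {R : W → W → Prop} {kn : ℕ → W → Set τ} {sent : ℕ → W → W → Set τ}
    (hfin : ∀ t w, (kn t w).Finite) (hkn : ∀ t w, kn t w ⊆ kn (t + 1) w)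
    (hsent : ∀ t w w', R w w' → sent t w w' ⊆ sent (t + 1) w w')
    (hrecv : ∀ t w w', R w w' → sent t w w' ⊆ kn t w')
    (hstep : ∀ t w w', R w w' → kn t w ⊆ sent t w w' ∨
      ∃ a ∈ sent (t + 1) w w', a ∉ sent t w w') (i : ℕ) :
    ∀ t, i ≤ t → ∀ w, reachTokens R (kn 0) i w ⊆ kn t w ∨ t + 1 ≤ (kn t w).ncard + i := by
  have mono : ∀ w, Monotone fun t => kn t w := fun w => monotone_nat_of_le_succ fun t => hkn t w
  induction i with
  | zero => exact fun t _ w => Or.inl (mono w (Nat.zero_le t))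
  | succ i ih =>
    -- The same dichotomy for a single link: if the link carries nothing new, it has already carried
    -- all that `w` knows, and the induction hypothesis for `w` applies; otherwise the number of
    -- sent tokens grows by one.
    have key : ∀ w w', R w w' → ∀ t, i ≤ t →
        reachTokens R (kn 0) i w ⊆ sent t w w' ∨ t ≤ (sent t w w').ncard + i := by
      intro w w' hR t ht
      induction t, ht using Nat.le_induction with
      | base => exact Or.inr (by omega)
      | succ t ht iht =>
        have hf : (sent (t + 1) w w').Finite := (hfin _ _).subset (hrecv _ _ _ hR)
        rcases iht with h | h
        · exact Or.inl (h.trans (hsent _ _ _ hR))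
        rcases hstep t w w' hR with h' | ⟨a, ha, ha'⟩
        · rcases ih t ht w with h2 | h2
          · exact Or.inl (h2.trans (h'.trans (hsent _ _ _ hR)))
          · refine Or.inr ?_
            have := Set.ncard_le_ncard (h'.trans (hsent t w w' hR)) hf
            omega
        · refine Or.inr ?_
          have : (sent t w w').ncard < (sent (t + 1) w w').ncard :=
            Set.ncard_lt_ncard ⟨hsent t w w' hR, fun h => ha' (h ha)⟩ hf
          omega
    intro t ht w
    by_contra! hcon
    obtain ⟨h1, h2⟩ := hcon
    refine h1 ?_
    rintro a (ha | ⟨w', hR, ha⟩)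
    · rcases ih t (by omega) w with h | h
      · exact h ha
      · omega
    · rcases key w' w hR t (by omega) with h | h
      · exact hrecv _ _ _ hR (h ha)
      · have := Set.ncard_le_ncard (hrecv t w' w hR) (hfin t w)
        omega

end Flooding

/-! ### Rooted forests, channels and groups. -/

/-- A rooted forest in a network. The parent of a root is irrelevant. -/
structure Forest {V : Type} (N : Network V) where
  IsRoot : V → Prop
  par : V → V
  depth : V → ℕ
  adj_par : ∀ v, ¬ IsRoot v → N.graph.Adj v (par v)
  depth_par : ∀ v, ¬ IsRoot v → depth (par v) + 1 = depth v

namespace Forest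

variable {V : Type} {N : Network V} (Fo : Forest N)

/-- `c` is a child of `v`. -/
def IsChild (c v : V) : Prop := ¬ Fo.IsRoot c ∧ Fo.par c = v

variable {Fo}

theorem IsChild.adj {c v : V} (h : Fo.IsChild c v) : N.graph.Adj v c :=
  h.2 ▸ (Fo.adj_par c h.1).symm

theorem IsChild.depth {c v : V} (h : Fo.IsChild c v) : Fo.depth c = Fo.depth v + 1 := by
  rw [← h.2, Fo.depth_par c h.1]

variable (Fo)

/-- The child edges of every node are distributed over channels by `ch`; the parent edge belongs to
channel `0`. Climb along channel `0` as long as possible. The result names the group of `v`. -/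
noncomputable def top (ch : V → V → ℕ) (v : V) : V × ℕ :=
  open Classical in
  if _h : Fo.IsRoot v then (v, 0)
  else if ch (Fo.par v) v = 0 then top ch (Fo.par v) else (Fo.par v, ch (Fo.par v) v)
termination_by Fo.depth v
decreasing_by
  have := Fo.depth_par v _h
  omega

/-- The name of the group that uses channel `j` of `v`. -/
noncomputable def chanTop (ch : V → V → ℕ) (w : V × ℕ) : V × ℕ :=
  if w.2 = 0 then Fo.top ch w.1 else w

variable {Fo}
variable {ch : V → V → ℕ}

theorem top_root {v : V} (h : Fo.IsRoot v) : Fo.top ch v = (v, 0) := by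
  rw [top, dif_pos h]

theorem top_of_not_root {v : V} (h : ¬ Fo.IsRoot v) :
    Fo.top ch v = Fo.chanTop ch (Fo.par v, ch (Fo.par v) v) := by
  rw [top, dif_neg h, chanTop]

theorem chanTop_zero (v : V) : Fo.chanTop ch (v, 0) = Fo.top ch v := by
  simp [chanTop]

theorem depth_induction {P : V → Prop} (hroot : ∀ v, Fo.IsRoot v → P v)
    (hstep : ∀ v, ¬ Fo.IsRoot v → P (Fo.par v) → P v) (v : V) : P v := by
  induction hd : Fo.depth v using Nat.strong_induction_on generalizing v with
  | _ n ih =>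
    by_cases h : Fo.IsRoot v
    · exact hroot v h
    · have := Fo.depth_par v h
      exact hstep v h (ih _ (by omega) _ rfl)

variable (Fo ch) in
/-- The links between the channels of adjacent nodes. -/
def Link (w w' : V × ℕ) : Prop :=
  (∃ c, ¬ Fo.IsRoot c ∧ w = (c, 0) ∧ w' = (Fo.par c, ch (Fo.par c) c)) ∨
    ∃ c, ¬ Fo.IsRoot c ∧ w' = (c, 0) ∧ w = (Fo.par c, ch (Fo.par c) c)

theorem Link.chanTop_eq {w w' : V × ℕ} (h : Fo.Link ch w w') :
    Fo.chanTop ch w = Fo.chanTop ch w' := by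
  rcases h with ⟨c, hc, rfl, rfl⟩ | ⟨c, hc, rfl, rfl⟩
  · rw [chanTop_zero, top_of_not_root hc]
  · rw [chanTop_zero, top_of_not_root hc]

theorem reachTokens_mono {W τ : Type} {R : W → W → Prop} {init : W → Set τ} {i j : ℕ} (h : i ≤ j)
    (w : W) : reachTokens R init i w ⊆ reachTokens R init j w := by
  induction j, h using Nat.le_induction with
  | base => exact subset_rfl
  | succ j _ ih => exact ih.trans Set.subset_union_left

/-- Each hop of the climb from `u` leaves another node of the group that is no deeper than `u`. The
connector at which a closed group ends is not counted; its child accounts for the last hop. -/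
theorem exists_hops [Finite V] {τ : Type} (init : V × ℕ → Set τ) (u : V) :
    ∃ i ≤ {x | Fo.top ch x = Fo.top ch u ∧ Fo.depth x ≤ Fo.depth u}.ncard,
      (∀ k, reachTokens (Fo.Link ch) init k (u, 0) ⊆
        reachTokens (Fo.Link ch) init (k + i) (Fo.top ch u)) ∧
      ∀ k, reachTokens (Fo.Link ch) init k (Fo.top ch u) ⊆
        reachTokens (Fo.Link ch) init (k + i) (u, 0) := by
  induction u using depth_induction with
  | hroot v h =>
    rw [top_root h]
    exact ⟨0, Nat.zero_le _, fun k => subset_rfl, fun k => subset_rfl⟩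
  | hstep v h ih =>
    have l1 : ∀ k, reachTokens (Fo.Link ch) init k (v, 0) ⊆
        reachTokens (Fo.Link ch) init (k + 1) (Fo.par v, ch (Fo.par v) v) := fun k a ha =>
      Or.inr ⟨_, Or.inl ⟨v, h, rfl, rfl⟩, ha⟩
    have l2 : ∀ k, reachTokens (Fo.Link ch) init k (Fo.par v, ch (Fo.par v) v) ⊆
        reachTokens (Fo.Link ch) init (k + 1) (v, 0) := fun k a ha =>
      Or.inr ⟨_, Or.inr ⟨v, h, rfl, rfl⟩, ha⟩
    have hd := Fo.depth_par v h
    by_cases h0 : ch (Fo.par v) v = 0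
    · have ht : Fo.top ch v = Fo.top ch (Fo.par v) := by
        rw [top_of_not_root h, h0, chanTop_zero]
      obtain ⟨i, hi, h1, h2⟩ := ih
      rw [h0] at l1 l2
      refine ⟨i + 1, ?_, fun k => ?_, fun k => ?_⟩
      · refine Nat.lt_of_le_of_lt hi (Set.ncard_lt_ncard ⟨?_, ?_⟩ (Set.toFinite _))
        · rintro x ⟨hx, hx'⟩
          exact ⟨hx.trans ht.symm, by omega⟩
        · intro hs
          have : Fo.depth v ≤ Fo.depth (Fo.par v) := (hs ⟨rfl, le_rfl⟩ : v ∈ _).2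
          omega
      · rw [ht, add_comm i, ← add_assoc]
        exact (l1 k).trans (h1 _)
      · rw [ht, ← add_assoc]
        exact (h2 k).trans (l2 _)
    · have ht : Fo.top ch v = (Fo.par v, ch (Fo.par v) v) := by
        rw [top_of_not_root h, chanTop, if_neg h0]
      refine ⟨1, ?_, fun k => ?_, fun k => ?_⟩
      · exact (Set.ncard_pos (Set.toFinite _)).2 ⟨v, rfl, le_rfl⟩
      · rw [ht]
        exact l1 k
      · rw [ht]
        exact l2 k

/-- At most `K` hops lead up from `u` to the place naming the group, and at most `K` lead down to
`v`. -/
theorem mem_reachTokens [Finite V] {τ : Type} {K : ℕ}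
    (hK : ∀ γ, {x | Fo.top ch x = γ}.ncard ≤ K) (init : V × ℕ → Set τ) {u v : V}
    (huv : Fo.top ch u = Fo.top ch v) {a : τ} (ha : a ∈ init (u, 0)) :
    a ∈ reachTokens (Fo.Link ch) init (2 * K) (v, 0) := by
  obtain ⟨i, hi, h1, -⟩ := exists_hops (Fo := Fo) (ch := ch) init u
  obtain ⟨j, hj, -, h2⟩ := exists_hops (Fo := Fo) (ch := ch) init v
  have hle : ∀ w, {x | Fo.top ch x = Fo.top ch w ∧ Fo.depth x ≤ Fo.depth w}.ncard ≤ K := fun w =>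
    (Set.ncard_le_ncard (fun x hx => hx.1) (Set.toFinite _)).trans (hK (Fo.top ch w))
  have := h2 _ (huv ▸ h1 0 ha)
  have h3 := hle u
  have h4 := hle v
  exact reachTokens_mono (by omega) _ this

end Forest

/-! ### Flooding inside the groups of a forest. -/

section FloodAlgorithm

variable {τ : Type}

open Classical in
/-- The channel of the edge to the neighbor with identifier `i`, from the identifier `po` of the
parent and the set `cc` of identifiers of children with their channels. -/
noncomputable def chanOf (a : Option ℕ × Set (ℕ × ℕ)) (i : ℕ) : Option ℕ :=
  if a.1 = some i then some 0 else if h : ∃ j, (i, j) ∈ a.2 then some h.choose else none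

open Classical in
/-- Some element of a set. -/
noncomputable def pick (A : Set τ) : Option τ := if h : A.Nonempty then some h.some else none

theorem pick_mem {A : Set τ} {a : τ} (h : pick A = some a) : a ∈ A := by
  unfold pick at h
  split_ifs at h with hA
  exact Option.some.inj h ▸ hA.some_mem

theorem pick_of_nonempty {A : Set τ} (h : A.Nonempty) : ∃ a ∈ A, pick A = some a :=
  ⟨h.some, h.some_mem, by rw [pick, dif_pos h]⟩

/-- The message to the neighbor with identifier `i`: a token known on its channel that was not yet
sent to it. The state holds the tokens known on each channel and those sent to each neighbor. -/
noncomputable def floodMsg (a : Option ℕ × Set (ℕ × ℕ)) (st : (ℕ → Set τ) × (ℕ → Set τ)) (i : ℕ) :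
    Option τ :=
  (chanOf a i).bind fun j => pick (st.1 j \ st.2 i)

/-- The update of the state in one round of flooding. -/
noncomputable def floodStep (a : Option ℕ × Set (ℕ × ℕ)) (st : (ℕ → Set τ) × (ℕ → Set τ))
    (inb : Set (ℕ × Option τ)) : (ℕ → Set τ) × (ℕ → Set τ) :=
  (fun j => st.1 j ∪ {x | ∃ i, (i, some x) ∈ inb ∧ chanOf a i = some j},
    fun i => st.2 i ∪ {x | floodMsg a st i = some x})

/-- The states during flooding. -/
noncomputable def floodState {V : Type} (N : Network V) (base : V → Option ℕ × Set (ℕ × ℕ))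
    (tok : V → τ) : ℕ → V → (ℕ → Set τ) × (ℕ → Set τ)
  | 0, v => (fun j => {x | j = 0 ∧ x = tok v}, fun _ => ∅)
  | t + 1, v => floodStep (base v) (floodState N base tok t v)
      (N.nbrData v fun u => floodMsg (base u) (floodState N base tok t u) (N.id v))

open Classical in
/-- What a node has to know about a forest with channels: the identifier of its parent, and
the identifiers and channels of its children. -/
noncomputable def Forest.localView {V : Type} {N : Network V} (Fo : Forest N) (ch : V → V → ℕ) (v : V) :
    Option ℕ × Set (ℕ × ℕ) :=
  (if Fo.IsRoot v then none else some (N.id (Fo.par v)),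
    {p | ∃ c, Fo.IsChild c v ∧ p = (N.id c, ch v c)})

variable {V : Type} {N : Network V} {Fo : Forest N} {ch : V → V → ℕ}

theorem chanOf_par {v : V} (h : ¬ Fo.IsRoot v) :
    chanOf (Fo.localView ch v) (N.id (Fo.par v)) = some 0 := by
  simp [chanOf, Forest.localView, h]

theorem chanOf_child {v c : V} (h : Fo.IsChild c v) :
    chanOf (Fo.localView ch v) (N.id c) = some (ch v c) := by
  -- The parent is one level higher and a child one level lower, so they cannot coincide.
  have h1 : ¬ (Fo.localView ch v).1 = some (N.id c) := by
    intro e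
    simp only [Forest.localView] at e
    split_ifs at e with hr
    have e' := N.id_injective (Option.some.inj e)
    have := Fo.depth_par v hr
    have := h.depth
    rw [e'] at *
    omega
  have h2 : ∃ j, (N.id c, j) ∈ (Fo.localView ch v).2 := ⟨_, c, h, rfl⟩
  rw [chanOf, if_neg h1, dif_pos h2]
  obtain ⟨c', hc', e⟩ := h2.choose_spec
  obtain ⟨e1, e2⟩ := Prod.mk.inj e
  rw [e2, N.id_injective e1]

theorem chanOf_eq_some {v u : V} {j : ℕ} (h : chanOf (Fo.localView ch v) (N.id u) = some j) :
    (¬ Fo.IsRoot v ∧ Fo.par v = u ∧ j = 0) ∨ (Fo.IsChild u v ∧ j = ch v u) := by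
  by_cases h1 : (Fo.localView ch v).1 = some (N.id u)
  · left
    simp only [chanOf, h1, if_true, Option.some.injEq] at h
    simp only [Forest.localView] at h1
    split_ifs at h1 with hr
    exact ⟨hr, N.id_injective (Option.some.inj h1), h.symm⟩
  · right
    by_cases h2 : ∃ j, (N.id u, j) ∈ (Fo.localView ch v).2
    · obtain ⟨j', c', hc', e⟩ := h2
      obtain ⟨e1, -⟩ := Prod.mk.inj e
      obtain rfl := N.id_injective e1
      exact ⟨hc', (Option.some.inj ((chanOf_child hc').symm.trans h)).symm⟩
    · rw [chanOf, if_neg h1, dif_neg h2] at h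
      exact absurd h (by simp)

theorem link_of_chanOf {v u : V} {j : ℕ} (h : chanOf (Fo.localView ch v) (N.id u) = some j) :
    ∃ j', chanOf (Fo.localView ch u) (N.id v) = some j' ∧ Fo.Link ch (v, j) (u, j') := by
  rcases chanOf_eq_some h with ⟨hr, rfl, rfl⟩ | ⟨hc, rfl⟩
  · exact ⟨_, chanOf_child ⟨hr, rfl⟩, Or.inl ⟨v, hr, rfl, rfl⟩⟩
  · obtain ⟨hr, rfl⟩ := hc
    exact ⟨0, chanOf_par hr, Or.inr ⟨u, hr, rfl, rfl⟩⟩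

theorem chanOf_of_link {w w' : V × ℕ} (h : Fo.Link ch w w') :
    N.graph.Adj w.1 w'.1 ∧ chanOf (Fo.localView ch w.1) (N.id w'.1) = some w.2 ∧
      chanOf (Fo.localView ch w'.1) (N.id w.1) = some w'.2 := by
  rcases h with ⟨c, hc, rfl, rfl⟩ | ⟨c, hc, rfl, rfl⟩
  · exact ⟨Fo.adj_par c hc, chanOf_par hc, chanOf_child ⟨hc, rfl⟩⟩
  · exact ⟨(Fo.adj_par c hc).symm, chanOf_child ⟨hc, rfl⟩, chanOf_par hc⟩

/-- Links preserve `chanTop`, so tokens never leave their group. Relaying at a connector is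
therefore harmless to other groups. -/
theorem floodState_subset (tok : V → τ) (t : ℕ) (v : V) (j : ℕ) :
    (floodState N (Fo.localView ch) tok t v).1 j ⊆
      tok '' {u | Fo.top ch u = Fo.chanTop ch (v, j)} := by
  induction t generalizing v j with
  | zero =>
    rintro x ⟨rfl, rfl⟩
    exact ⟨v, (Forest.chanTop_zero v).symm, rfl⟩
  | succ t ih =>
    rintro x (hx | ⟨i, ⟨u, hu, e⟩, hi⟩)
    · exact ih v j hx
    · obtain ⟨rfl, hx⟩ := Prod.mk.inj e
      obtain ⟨j', hj', hlink⟩ := link_of_chanOf hi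
      simp only [floodMsg, hj', Option.bind_some] at hx
      rw [hlink.chanTop_eq]
      exact ih u j' (pick_mem hx.symm).1

/-- Of the `3 * K` steps, `2 * K` pay for the hops and `K` for queueing: the second alternative of
`flooding` would require more than `K` tokens in a group of at most `K` nodes. -/
theorem floodState_eq [Finite V] {K : ℕ} (hK : ∀ γ, {x | Fo.top ch x = γ}.ncard ≤ K) (tok : V → τ)
    (v : V) : (floodState N (Fo.localView ch) tok (3 * K) v).1 0 =
      {x | ∃ u, Fo.top ch u = Fo.top ch v ∧ x = tok u} := by
  have hsub := floodState_subset (Fo := Fo) (ch := ch) tok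
  apply Set.Subset.antisymm
  · rintro x hx
    obtain ⟨u, hu, rfl⟩ := hsub _ _ _ hx
    exact ⟨u, (hu : _ = _).trans (Forest.chanTop_zero v), rfl⟩
  have hfl := flooding (R := Fo.Link ch)
    (kn := fun t w => (floodState N (Fo.localView ch) tok t w.1).1 w.2)
    (sent := fun t w w' => (floodState N (Fo.localView ch) tok t w.1).2 (N.id w'.1))
    (fun t w => (Set.toFinite _).subset (hsub t w.1 w.2))
    (fun t w => Set.subset_union_left) (fun t w w' _ => Set.subset_union_left)
    ?_ ?_ (2 * K) (3 * K) (by omega) (v, 0)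
  · rintro x ⟨u, hu, rfl⟩
    rcases hfl with h | h
    · exact h (Forest.mem_reachTokens hK _ hu ⟨rfl, rfl⟩)
    · have h1 := Set.ncard_le_ncard (hsub (3 * K) v 0) (Set.toFinite _)
      have h2 := Set.ncard_image_le (f := tok)
        (Set.toFinite {u | Fo.top ch u = Fo.chanTop ch (v, 0)})
      have h3 := hK (Fo.chanTop ch (v, 0))
      dsimp only at h
      omega
  · intro t w w' hR
    obtain ⟨hadj, h1, h2⟩ := chanOf_of_link hR
    induction t with
    | zero => exact Set.empty_subset _
    | succ t ih =>
      rintro x (hx | hx)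
      · exact Or.inl (ih hx)
      · exact Or.inr ⟨N.id w.1, ⟨w.1, hadj.symm, Prod.ext rfl hx.symm⟩, h2⟩
  · intro t w w' hR
    obtain ⟨hadj, h1, h2⟩ := chanOf_of_link hR
    by_cases hne : ((floodState N (Fo.localView ch) tok t w.1).1 w.2 \
        (floodState N (Fo.localView ch) tok t w.1).2 (N.id w'.1)).Nonempty
    · obtain ⟨a, ha, hp⟩ := pick_of_nonempty hne
      refine Or.inr ⟨a, Or.inr ?_, ha.2⟩
      show floodMsg _ _ _ = some a
      rw [floodMsg, h1]
      exact hp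
    · left
      rwa [Set.not_nonempty_iff_eq_empty, Set.sdiff_eq_empty] at hne

end FloodAlgorithm

/-- Flooding inside the groups: every node learns the tokens of its group. -/
theorem Known.flood {J : Type 1} {I α τ : Type} {V : J → Type} [∀ i, Finite (V i)] {b : ℕ}
    {N : ∀ i, Network (V i)} {x : ∀ i, V i → I} {T : ℕ} {X : ∀ i, V i → α}
    (h : Known b N x T X) {m : ℕ} (hm : 0 < m) (Fo : ∀ i, Forest (N i)) (ch : ∀ i, V i → V i → ℕ)
    (base : α → Option ℕ × Set (ℕ × ℕ)) (hbase : ∀ i v, base (X i v) = (Fo i).localView (ch i) v)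
    (tok : α → τ) {S : Set (Option τ)} (hS : S.Finite) (hcard : S.ncard ≤ 2 ^ (m * b))
    (hnone : none ∈ S) (htok : ∀ i v, some (tok (X i v)) ∈ S) {K : ℕ}
    (hK : ∀ i γ, {u | (Fo i).top (ch i) u = γ}.ncard ≤ K) :
    Known b N x (T + m * (3 * K)) (fun i v =>
      (X i v, {y | ∃ u, (Fo i).top (ch i) u = (Fo i).top (ch i) v ∧ y = tok (X i u)})) := by
  have hit := Known.iterate (N := N) (b := b) (x := x) (T := T) hm
    (fun (a : α × (ℕ → Set τ) × (ℕ → Set τ)) i => floodMsg (base a.1) a.2 i) hS hcard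
    (fun a inb => (a.1, floodStep (base a.1) a.2 inb))
    (fun t i v => (X i v, floodState (N i) ((Fo i).localView (ch i)) (fun u => tok (X i u)) t v))
    (h.map fun a => (a, (fun j => {y | j = 0 ∧ y = tok a}, fun _ => ∅))) ?_ ?_ (3 * K)
  · refine (hit.map fun a => (a.1, a.2.1 0)).congr fun i v => ?_
    simp only [Prod.mk.injEq, true_and]
    exact floodState_eq (hK i) _ v
  · intro t i v u _
    simp only [hbase]
    rcases hmsg : floodMsg ((Fo i).localView (ch i) u) (floodState (N i) ((Fo i).localView (ch i))
        (fun u => tok (X i u)) t u) ((N i).id v) with _ | y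
    · exact hnone
    · rw [floodMsg] at hmsg
      rcases hc : chanOf ((Fo i).localView (ch i) u) ((N i).id v) with _ | j
      · simp [hc] at hmsg
      · rw [hc] at hmsg
        obtain ⟨u', -, rfl⟩ := floodState_subset _ _ _ _ (pick_mem hmsg).1
        exact htok i u'
  · intro t i v
    simp only [hbase]
    rfl

/-! ### Groups of controlled size from weights. -/

section Weights

open Classical in
/-- The elements of a finite set. -/
noncomputable def finOf (A : Set (ℕ × ℕ)) : Finset (ℕ × ℕ) := if h : A.Finite then h.toFinset else ∅

theorem mem_finOf {A : Set (ℕ × ℕ)} (h : A.Finite) {a : ℕ × ℕ} : a ∈ finOf A ↔ a ∈ A := by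
  simp [finOf, h]

/-- The weight of a node whose children have the given identifiers and weights: the node itself
together with the children in chunk `0`. -/
noncomputable def weightOf (s : ℕ) (A : Set (ℕ × ℕ)) : ℕ :=
  1 + ∑ a ∈ finOf A with chunk s (finOf A) a = 0, a.2

end Weights

namespace Forest

variable {V : Type} {N : Network V} (Fo : Forest N)

theorem wellFounded_depth_gt [Finite V] : WellFounded fun c v => Fo.depth v < Fo.depth c :=
  have : IsTrans V fun c v => Fo.depth v < Fo.depth c := ⟨fun _ _ _ h h' => lt_trans h' h⟩
  have : Std.Irrefl fun c v => Fo.depth v < Fo.depth c := ⟨fun _ => lt_irrefl _⟩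
  Finite.wellFounded_of_trans_of_irrefl _

/-- The weights of the nodes, computed from the leaves to the roots. -/
noncomputable def weight [Finite V] (s : ℕ) : V → ℕ :=
  Fo.wellFounded_depth_gt.fix fun v rec =>
    weightOf s {p | ∃ c, ∃ h : Fo.IsChild c v, p = (N.id c, rec c (by rw [h.depth]; omega))}

/-- The identifiers and weights of the children of a node. -/
def childData [Finite V] (s : ℕ) (v : V) : Set (ℕ × ℕ) :=
  {p | ∃ c, Fo.IsChild c v ∧ p = (N.id c, Fo.weight s c)}

/-- The channels given by the chunking of the children. -/
noncomputable def chunkCh [Finite V] (s : ℕ) (v c : V) : ℕ :=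
  chunk s (finOf (Fo.childData s v)) (N.id c, Fo.weight s c)

theorem weight_eq [Finite V] (s : ℕ) (v : V) : Fo.weight s v = weightOf s (Fo.childData s v) := by
  rw [weight, WellFounded.fix_eq]
  congr 1
  ext p
  constructor
  · rintro ⟨c, h, rfl⟩
    exact ⟨c, h, rfl⟩
  · rintro ⟨c, h, rfl⟩
    exact ⟨c, h, rfl⟩

variable {Fo}

theorem induction_leaves [Finite V] {P : V → Prop} (h : ∀ v, (∀ c, Fo.IsChild c v → P c) → P v)
    (v : V) : P v := by
  induction v using Fo.wellFounded_depth_gt.induction with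
  | _ v ih => exact h v fun c hc => ih c (by rw [hc.depth]; omega)

theorem childData_finite [Finite V] (s : ℕ) (v : V) : (Fo.childData s v).Finite :=
  (Set.finite_range fun c => (N.id c, Fo.weight s c)).subset fun _ ⟨c, _, h⟩ => ⟨c, h.symm⟩

theorem weight_le [Finite V] {s : ℕ} (hs : 0 < s) (v : V) : Fo.weight s v ≤ s := by
  induction v using induction_leaves (Fo := Fo) with
  | h v ih =>
    rw [weight_eq, weightOf]
    have := (isChunking_chunk hs (A := finOf (Fo.childData s v)) ?_).1
    · omega
    · intro a ha
      obtain ⟨c, hc, rfl⟩ := (mem_finOf (childData_finite s v)).1 ha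
      exact ih c hc

theorem isChunking_childData [Finite V] {s : ℕ} (hs : 0 < s) (v : V) :
    IsChunking s (finOf (Fo.childData s v)) (chunk s (finOf (Fo.childData s v))) := by
  refine isChunking_chunk hs ?_
  intro a ha
  obtain ⟨c, hc, rfl⟩ := (mem_finOf (childData_finite s v)).1 ha
  exact weight_le hs c

variable (Fo) in
/-- The nodes from which `v` is reached by climbing along channel `0`. -/
def sub (ch : V → V → ℕ) (v : V) : Set V :=
  {u | Relation.ReflTransGen (fun a b => ¬ Fo.IsRoot a ∧ Fo.par a = b ∧ ch b a = 0) u v}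

variable {ch : V → V → ℕ}

theorem depth_le_of_mem_sub {u v : V} (h : u ∈ Fo.sub ch v) : u = v ∨ Fo.depth v < Fo.depth u := by
  have h' : Relation.ReflTransGen _ u v := h
  induction h' using Relation.ReflTransGen.head_induction_on with
  | refl => exact Or.inl rfl
  | head hab hbc ih =>
    obtain ⟨h1, rfl, -⟩ := hab
    have := Fo.depth_par _ h1
    rcases ih hbc with e | h
    · right
      rw [← e]
      omega
    · right
      omega

/-- Climbing is a partial function, so of two nodes reached from `u` one is reached from the other.
This makes the open groups of distinct siblings disjoint. -/
theorem eq_of_mem_sub {u v w : V} (hv : u ∈ Fo.sub ch v) (hw : u ∈ Fo.sub ch w)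
    (hd : Fo.depth v = Fo.depth w) : v = w := by
  have U : Relator.RightUnique fun a b => ¬ Fo.IsRoot a ∧ Fo.par a = b ∧ ch b a = 0 :=
    fun a b c hb hc => hb.2.1.symm.trans hc.2.1
  rcases Relation.ReflTransGen.total_of_right_unique U hv hw with h | h
  · rcases depth_le_of_mem_sub (show v ∈ Fo.sub ch w from h) with h | h
    · exact h
    · omega
  · rcases depth_le_of_mem_sub (show w ∈ Fo.sub ch v from h) with h | h
    · exact h.symm
    · omega

theorem top_of_mem_sub {u v : V} (h : u ∈ Fo.sub ch v) : Fo.top ch u = Fo.top ch v := by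
  have h' : Relation.ReflTransGen _ u v := h
  clear h
  induction h' using Relation.ReflTransGen.head_induction_on with
  | refl => rfl
  | head hab _ ih =>
    obtain ⟨h1, rfl, h2⟩ := hab
    rw [top_of_not_root h1, h2, chanTop_zero, ih]

theorem exists_summit (u : V) : ∃ v, u ∈ Fo.sub ch v ∧
    (Fo.IsRoot v ∨ ¬ Fo.IsRoot v ∧ ch (Fo.par v) v ≠ 0) := by
  induction u using depth_induction (Fo := Fo) with
  | hroot v h => exact ⟨v, Relation.ReflTransGen.refl, Or.inl h⟩
  | hstep v h ih =>
    by_cases h0 : ch (Fo.par v) v = 0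
    · obtain ⟨w, hw, hw'⟩ := ih
      exact ⟨w, Relation.ReflTransGen.head ⟨h, rfl, h0⟩ hw, hw'⟩
    · exact ⟨v, Relation.ReflTransGen.refl, Or.inr ⟨h, h0⟩⟩

/-- The climb stops at a root or at a child in a nonzero channel, so only two kinds of groups exist:
the remainder at a root, and the children's open groups joined through a connector `y`. -/
theorem top_cases (u : V) : (∃ ρ, Fo.IsRoot ρ ∧ u ∈ Fo.sub ch ρ ∧ Fo.top ch u = (ρ, 0)) ∨
    ∃ y c, Fo.IsChild c y ∧ ch y c ≠ 0 ∧ u ∈ Fo.sub ch c ∧ Fo.top ch u = (y, ch y c) := by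
  obtain ⟨v, hv, h | ⟨h, h0⟩⟩ := exists_summit (Fo := Fo) (ch := ch) u
  · exact Or.inl ⟨v, h, hv, by rw [top_of_mem_sub hv, top_root h]⟩
  · exact Or.inr ⟨_, v, ⟨h, rfl⟩, h0, hv, by
      rw [top_of_mem_sub hv, top_of_not_root h, chanTop, if_neg h0]⟩

theorem sub_eq (v : V) :
    Fo.sub ch v = insert v (⋃ c ∈ {c | Fo.IsChild c v ∧ ch v c = 0}, Fo.sub ch c) := by
  ext u
  simp only [Set.mem_insert_iff, Set.mem_iUnion, exists_prop]
  constructor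
  · intro h
    rcases Relation.ReflTransGen.cases_tail h with h | ⟨c, hc, h1, h2, h3⟩
    · exact Or.inl h.symm
    · exact Or.inr ⟨c, ⟨⟨h1, h2⟩, h3⟩, hc⟩
  · rintro (rfl | ⟨c, ⟨⟨h1, h2⟩, h3⟩, hc⟩)
    · exact Relation.ReflTransGen.refl
    · exact Relation.ReflTransGen.tail hc ⟨h1, h2, h3⟩

theorem top_fiber_root {ρ : V} (h : Fo.IsRoot ρ) : {u | Fo.top ch u = (ρ, 0)} = Fo.sub ch ρ := by
  ext u
  constructor
  · intro hu
    rcases top_cases (Fo := Fo) (ch := ch) u with ⟨ρ', _, h2, h3⟩ | ⟨y, c, _, h2, _, h3⟩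
    · have := (Prod.mk.inj (h3.symm.trans hu)).1
      rwa [this] at h2
    · exact absurd (Prod.mk.inj (h3.symm.trans hu)).2 h2
  · intro hu
    exact (top_of_mem_sub hu).trans (top_root h)

theorem top_fiber_closed {y : V} {j : ℕ} (hj : j ≠ 0) :
    {u | Fo.top ch u = (y, j)} = ⋃ c ∈ {c | Fo.IsChild c y ∧ ch y c = j}, Fo.sub ch c := by
  ext u
  simp only [Set.mem_iUnion, exists_prop]
  constructor
  · intro hu
    rcases top_cases (Fo := Fo) (ch := ch) u with ⟨ρ', _, h2, h3⟩ | ⟨y', c, h1, h2, h4, h3⟩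
    · exact absurd (Prod.mk.inj (h3.symm.trans hu)).2.symm hj
    · obtain ⟨rfl, h⟩ := Prod.mk.inj (h3.symm.trans hu)
      exact ⟨c, ⟨h1, h⟩, h4⟩
  · rintro ⟨c, ⟨⟨h1, rfl⟩, rfl⟩, hu⟩
    exact (top_of_mem_sub hu).trans (by rw [top_of_not_root h1, chanTop, if_neg hj])

theorem ncard_biUnion_sub [Finite V] (v : V) (j : ℕ) {r : V → ℕ}
    (hr : ∀ c, Fo.IsChild c v → (Fo.sub ch c).ncard = r c) :
    (⋃ c ∈ {c | Fo.IsChild c v ∧ ch v c = j}, Fo.sub ch c).ncard =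
      ∑ c ∈ (Set.toFinite {c | Fo.IsChild c v ∧ ch v c = j}).toFinset, r c := by
  classical
  have := Fintype.ofFinite V
  let f : V → Finset V := fun c => (Set.toFinite (Fo.sub ch c)).toFinset
  have e : (⋃ c ∈ {c | Fo.IsChild c v ∧ ch v c = j}, Fo.sub ch c) =
      (((Set.toFinite {c | Fo.IsChild c v ∧ ch v c = j}).toFinset.biUnion f : Finset V) : Set V) := by
    ext u
    simp [f]
  rw [e, Set.ncard_coe_finset, Finset.card_biUnion]
  · refine Finset.sum_congr rfl fun c hc => ?_
    have hc : Fo.IsChild c v ∧ ch v c = j := by simpa using hc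
    rw [← hr c hc.1, Set.ncard_eq_toFinset_card _ (Set.toFinite _)]
  · intro c hc c' hc' hne
    have hc : Fo.IsChild c v ∧ ch v c = j := by simpa using hc
    have hc' : Fo.IsChild c' v ∧ ch v c' = j := by simpa using hc'
    rw [Function.onFun, Finset.disjoint_left]
    intro u hu hu'
    simp only [f, Set.Finite.mem_toFinset] at hu hu'
    exact hne (eq_of_mem_sub hu hu' (by rw [hc.1.depth, hc'.1.depth]))

theorem sum_chunk [Finite V] (s : ℕ) (v : V) (j : ℕ) :
    ∑ c ∈ (Set.toFinite {c | Fo.IsChild c v ∧ Fo.chunkCh s v c = j}).toFinset, Fo.weight s c =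
      ∑ a ∈ finOf (Fo.childData s v) with chunk s (finOf (Fo.childData s v)) a = j, a.2 := by
  refine Finset.sum_nbij (fun c => (N.id c, Fo.weight s c)) ?_ ?_ ?_ ?_
  · intro c hc
    have hc : Fo.IsChild c v ∧ Fo.chunkCh s v c = j := by simpa using hc
    rw [Finset.mem_filter, mem_finOf (childData_finite s v)]
    exact ⟨⟨c, hc.1, rfl⟩, hc.2⟩
  · intro c _ c' _ h
    exact N.id_injective (Prod.mk.inj h).1
  · intro a ha
    rw [Finset.mem_coe, Finset.mem_filter, mem_finOf (childData_finite s v)] at ha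
    obtain ⟨⟨c, hc, rfl⟩, h⟩ := ha
    exact ⟨c, by simpa using ⟨hc, h⟩, rfl⟩
  · intro c _
    rfl

/-- The locally computable weight is the true size of the open group, so bounds on chunk weights
become bounds on group sizes. -/
theorem ncard_sub [Finite V] (s : ℕ) (v : V) :
    (Fo.sub (Fo.chunkCh s) v).ncard = Fo.weight s v := by
  induction v using induction_leaves (Fo := Fo) with
  | h v ih =>
    rw [sub_eq, Set.ncard_insert_of_notMem _ (Set.toFinite _), ncard_biUnion_sub v 0 ih, sum_chunk,
      weight_eq, weightOf, add_comm]
    simp only [Set.mem_iUnion, exists_prop, not_exists, not_and]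
    rintro c ⟨hc, -⟩ hv
    have := hc.depth
    rcases depth_le_of_mem_sub hv with h | h
    · rw [h] at this
      omega
    · omega

variable (Fo) in
/-- Some chunk other than chunk `0` is formed at `v`. -/
def IsConnector [Finite V] (s : ℕ) (v : V) : Prop :=
  ∃ a ∈ Fo.childData s v, chunk s (finOf (Fo.childData s v)) a ≠ 0

theorem ncard_top_zero_le [Finite V] {s : ℕ} (hs : 0 < s) (ρ : V) :
    {u | Fo.top (Fo.chunkCh s) u = (ρ, 0)}.ncard ≤ s := by
  by_cases h : Fo.IsRoot ρ
  · rw [top_fiber_root h, ncard_sub]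
    exact weight_le hs ρ
  · have : {u | Fo.top (Fo.chunkCh s) u = (ρ, 0)} = ∅ := by
      rw [Set.eq_empty_iff_forall_notMem]
      intro u hu
      rcases top_cases (Fo := Fo) (ch := Fo.chunkCh s) u with ⟨ρ', h1, h2, h3⟩ | ⟨y, c, _, h2, _, h3⟩
      · rw [(Prod.mk.inj (h3.symm.trans hu)).1] at h1
        exact h h1
      · exact h2 (Prod.mk.inj (h3.symm.trans hu)).2
    simp [this]

theorem ncard_top_closed [Finite V] {s : ℕ} (hs : 0 < s) (y : V) {j : ℕ} (hj : j ≠ 0) :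
    {u | Fo.top (Fo.chunkCh s) u = (y, j)}.ncard ≤ 2 * s ∧
      ((∃ a ∈ Fo.childData s y, chunk s (finOf (Fo.childData s y)) a = j) →
        s ≤ {u | Fo.top (Fo.chunkCh s) u = (y, j)}.ncard) := by
  rw [top_fiber_closed hj, ncard_biUnion_sub y j (fun c _ => ncard_sub s c), sum_chunk]
  have h := (isChunking_childData (Fo := Fo) hs y).2 j hj
  refine ⟨?_, fun ⟨a, ha, haj⟩ => (h ⟨a, (mem_finOf (childData_finite s y)).2 ha, haj⟩).1⟩
  by_cases hne : ∃ a ∈ finOf (Fo.childData s y), chunk s (finOf (Fo.childData s y)) a = j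
  · exact (h hne).2.le
  · rw [Finset.filter_false_of_mem fun a ha e => hne ⟨a, ha, e⟩]
    simp

theorem ncard_top_chunkCh_le [Finite V] {s : ℕ} (hs : 0 < s) (γ : V × ℕ) :
    {u | Fo.top (Fo.chunkCh s) u = γ}.ncard ≤ 2 * s := by
  obtain ⟨y, j⟩ := γ
  by_cases hj : j = 0
  · subst hj
    have := ncard_top_zero_le (Fo := Fo) hs y
    omega
  · exact (ncard_top_closed hs y hj).1

/-! ### Merging the possibly small groups of the roots. -/

/-- The first chunk other than chunk `0`. -/
noncomputable def firstChunk (s : ℕ) (A : Set (ℕ × ℕ)) : ℕ :=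
  sInf {j | j ≠ 0 ∧ ∃ a ∈ A, chunk s (finOf A) a = j}

theorem firstChunk_spec [Finite V] {s : ℕ} {v : V} (h : Fo.IsConnector s v) :
    firstChunk s (Fo.childData s v) ≠ 0 ∧ ∃ a ∈ Fo.childData s v,
      chunk s (finOf (Fo.childData s v)) a = firstChunk s (Fo.childData s v) := by
  obtain ⟨a, ha, h0⟩ := h
  exact Nat.sInf_mem (s := {j | j ≠ 0 ∧ ∃ a ∈ Fo.childData s v,
    chunk s (finOf (Fo.childData s v)) a = j}) ⟨_, h0, a, ha, rfl⟩

variable (Fo) in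
/-- `v` is the connector with the smallest identifier in the group of a root. -/
def IsStar [Finite V] (s : ℕ) (v : V) : Prop :=
  Fo.IsConnector s v ∧ (∃ ρ, Fo.top (Fo.chunkCh s) ρ = Fo.top (Fo.chunkCh s) v ∧ Fo.IsRoot ρ) ∧
    ∀ u, Fo.top (Fo.chunkCh s) u = Fo.top (Fo.chunkCh s) v → Fo.IsConnector s u → N.id v ≤ N.id u

open Classical in
variable (Fo) in
/-- The channels in which the group of every root is merged with the first chunk formed at its
star. -/
noncomputable def mergedCh [Finite V] (s : ℕ) (v c : V) : ℕ :=
  if Fo.IsStar s v ∧ Fo.chunkCh s v c = firstChunk s (Fo.childData s v) then 0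
  else Fo.chunkCh s v c

open Classical in
variable (Fo) in
/-- The effect of the merging on the names of groups. -/
noncomputable def mergeName [Finite V] (s : ℕ) (γ : V × ℕ) : V × ℕ :=
  if Fo.IsStar s γ.1 ∧ γ.2 = firstChunk s (Fo.childData s γ.1) then Fo.top (Fo.chunkCh s) γ.1 else γ

theorem IsStar.top_eq [Finite V] {s : ℕ} {v : V} (h : Fo.IsStar s v) :
    ∃ ρ, Fo.IsRoot ρ ∧ Fo.top (Fo.chunkCh s) v = (ρ, 0) := by
  obtain ⟨ρ, h1, h2⟩ := h.2.1
  exact ⟨ρ, h2, by rw [← h1, top_root h2]⟩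

theorem mergeName_zero [Finite V] {s : ℕ} (y : V) : Fo.mergeName s (y, 0) = (y, 0) := by
  rw [mergeName, if_neg]
  rintro ⟨h1, h2⟩
  exact (firstChunk_spec h1.1).1 h2.symm

/-- Only the first chunk at a star is renamed. Its climb now continues from the star, which lies in
a root's group, and the name of such a group is fixed by `mergeName`. -/
theorem top_mergedCh [Finite V] (s : ℕ) (u : V) :
    Fo.top (Fo.mergedCh s) u = Fo.mergeName s (Fo.top (Fo.chunkCh s) u) := by
  induction u using depth_induction (Fo := Fo) with
  | hroot v h => rw [top_root h, top_root h, mergeName_zero]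
  | hstep v h ih =>
    rw [top_of_not_root h, top_of_not_root h]
    by_cases h0 : Fo.chunkCh s (Fo.par v) v = 0
    · have h1 : Fo.mergedCh s (Fo.par v) v = 0 := by
        rw [mergedCh]
        split_ifs
        · rfl
        · exact h0
      rw [h0, h1, chanTop_zero, chanTop_zero, ih]
    · by_cases hs : Fo.IsStar s (Fo.par v) ∧
          Fo.chunkCh s (Fo.par v) v = firstChunk s (Fo.childData s (Fo.par v))
      · obtain ⟨ρ, hρ, e⟩ := hs.1.top_eq
        rw [mergedCh, if_pos hs, chanTop_zero, ih, e, mergeName_zero, chanTop, if_neg h0, mergeName,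
          if_pos hs, e]
      · rw [mergedCh, if_neg hs, chanTop, if_neg h0, chanTop, if_neg h0, mergeName, if_neg hs]

/-- Minimality of the identifier makes the star of a root's group unique, so a remainder of size at
most `s` absorbs only one chunk of size at most `2 * s`. -/
theorem ncard_top_mergedCh_le [Finite V] {s : ℕ} (hs : 0 < s) (γ : V × ℕ) :
    {u | Fo.top (Fo.mergedCh s) u = γ}.ncard ≤ 3 * s := by
  have h1 := ncard_top_chunkCh_le (Fo := Fo) hs γ
  by_cases hstar : ∃ y, Fo.IsStar s y ∧ Fo.top (Fo.chunkCh s) y = γ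
  · obtain ⟨y, hy, hyγ⟩ := hstar
    obtain ⟨ρ, -, e⟩ := hy.top_eq
    have hγ : γ = (ρ, 0) := hyγ.symm.trans e
    have h2 := ncard_top_zero_le (Fo := Fo) hs ρ
    have h3 := (ncard_top_closed (Fo := Fo) hs y (firstChunk_spec hy.1).1).1
    have hsub : {u | Fo.top (Fo.mergedCh s) u = γ} ⊆ {u | Fo.top (Fo.chunkCh s) u = (ρ, 0)} ∪
        {u | Fo.top (Fo.chunkCh s) u = (y, firstChunk s (Fo.childData s y))} := by
      intro u hu
      have hu : Fo.top (Fo.mergedCh s) u = γ := hu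
      rw [top_mergedCh, mergeName] at hu
      split_ifs at hu with h
      · right
        have e1 : (Fo.top (Fo.chunkCh s) u).1 = y := by
          apply N.id_injective
          apply le_antisymm
          · exact h.1.2.2 y (hyγ.trans hu.symm) hy.1
          · exact hy.2.2 _ (hu.trans hyγ.symm) h.1.1
        exact Prod.ext e1 (by rw [h.2, e1])
      · left
        exact hu.trans hγ
    have h4 := Set.ncard_le_ncard hsub (Set.toFinite _)
    have h5 := Set.ncard_union_le {u | Fo.top (Fo.chunkCh s) u = (ρ, 0)}
        {u | Fo.top (Fo.chunkCh s) u = (y, firstChunk s (Fo.childData s y))}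
    omega
  · have hsub : {u | Fo.top (Fo.mergedCh s) u = γ} ⊆ {u | Fo.top (Fo.chunkCh s) u = γ} := by
      intro u hu
      have hu : Fo.top (Fo.mergedCh s) u = γ := hu
      rw [top_mergedCh, mergeName] at hu
      split_ifs at hu with h
      · exact absurd ⟨_, h.1, hu⟩ hstar
      · exact hu
    have := Set.ncard_le_ncard hsub (Set.toFinite _)
    omega

theorem exists_isStar [Finite V] {s : ℕ} {ρ : V} (hρ : Fo.IsRoot ρ)
    (h : ∃ y, Fo.top (Fo.chunkCh s) y = (ρ, 0) ∧ Fo.IsConnector s y) :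
    ∃ y, Fo.IsStar s y ∧ Fo.top (Fo.chunkCh s) y = (ρ, 0) := by
  obtain ⟨y, ⟨hy1, hy2⟩, hmin⟩ := Set.exists_min_image
    {y | Fo.top (Fo.chunkCh s) y = (ρ, 0) ∧ Fo.IsConnector s y} N.id (Set.toFinite _) h
  refine ⟨y, ⟨hy2, ⟨ρ, by rw [hy1, top_root hρ], hρ⟩, ?_⟩, hy1⟩
  intro u hu hu'
  exact hmin u ⟨hu.trans hy1, hu'⟩

/-- Closed chunks are large enough by themselves; a root's group is large enough because `hconn`
provides a whole chunk for it to absorb. -/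
theorem le_ncard_top_mergedCh [Finite V] {s : ℕ} (hs : 0 < s)
    (hconn : ∀ ρ, Fo.IsRoot ρ → ∃ y, Fo.top (Fo.chunkCh s) y = (ρ, 0) ∧ Fo.IsConnector s y) (v : V) :
    s ≤ {u | Fo.top (Fo.mergedCh s) u = Fo.top (Fo.mergedCh s) v}.ncard := by
  have hroot : ∀ ρ, Fo.IsRoot ρ → s ≤ {u | Fo.top (Fo.mergedCh s) u = (ρ, 0)}.ncard := by
    intro ρ hρ
    obtain ⟨y, hy, e⟩ := exists_isStar hρ (hconn ρ hρ)
    obtain ⟨hj, ha⟩ := firstChunk_spec hy.1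
    refine ((ncard_top_closed hs y hj).2 ha).trans (Set.ncard_le_ncard ?_ (Set.toFinite _))
    intro u hu
    have hu : Fo.top (Fo.chunkCh s) u = _ := hu
    show Fo.top (Fo.mergedCh s) u = (ρ, 0)
    rw [top_mergedCh, hu, mergeName, if_pos ⟨hy, rfl⟩, e]
  rw [top_mergedCh (u := v), mergeName]
  split_ifs with h
  · obtain ⟨ρ, hρ, e⟩ := h.1.top_eq
    rw [e]
    exact hroot ρ hρ
  · rcases top_cases (Fo := Fo) (ch := Fo.chunkCh s) v with ⟨ρ, h1, h2, h3⟩ | ⟨y, c, h1, h2, h4, h3⟩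
    · rw [h3]
      exact hroot ρ h1
    · refine ((ncard_top_closed hs y h2).2 ⟨_, ⟨c, h1, rfl⟩, rfl⟩).trans
        (Set.ncard_le_ncard ?_ (Set.toFinite _))
      intro u hu
      have hu : Fo.top (Fo.chunkCh s) u = _ := hu
      show Fo.top (Fo.mergedCh s) u = _
      rw [top_mergedCh, hu, ← h3, mergeName, if_neg h]

end Forest

/-! ### The breadth-first search forest of the local identifier minima. -/

namespace Network

variable {V : Type} (N : Network V)

/-- The smallest identifier within `t` hops of a node. -/
noncomputable def minId : ℕ → V → ℕ
  | 0, v => N.id v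
  | t + 1, v => sInf ({minId t v} ∪ {y | ∃ i, (i, y) ∈ N.nbrData v (minId t)})

/-- The identifier of `v` is the smallest within `L` hops. -/
def IsLocalMin (L : ℕ) (v : V) : Prop := N.minId L v = N.id v

theorem minId_succ_le_self (t : ℕ) (v : V) : N.minId (t + 1) v ≤ N.minId t v :=
  Nat.sInf_le (Or.inl rfl)

theorem minId_succ_le_of_adj (t : ℕ) {v u : V} (h : N.graph.Adj v u) :
    N.minId (t + 1) v ≤ N.minId t u :=
  Nat.sInf_le (Or.inr ⟨N.id u, u, h, rfl⟩)

theorem exists_minId_eq (t : ℕ) (v : V) : ∃ u, N.minId t v = N.id u := by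
  induction t generalizing v with
  | zero => exact ⟨v, rfl⟩
  | succ t ih =>
    have hmem := Nat.sInf_mem
      (s := {N.minId t v} ∪ {y | ∃ i, (i, y) ∈ N.nbrData v (N.minId t)}) ⟨_, Or.inl rfl⟩
    rcases hmem with h | ⟨i, u, hu, h⟩
    · obtain ⟨u, hu⟩ := ih v
      exact ⟨u, (show N.minId (t + 1) v = N.minId t v from h).trans hu⟩
    · obtain ⟨w, hw⟩ := ih u
      exact ⟨w, (show N.minId (t + 1) v = N.minId t u from (Prod.mk.inj h).2).trans hw⟩

theorem minId_le_of_walk {v u : V} (p : N.graph.Walk v u) {t : ℕ} (h : p.length ≤ t) :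
    N.minId t v ≤ N.id u := by
  induction p generalizing t with
  | nil =>
    clear h
    induction t with
    | zero => exact le_rfl
    | succ t ih => exact (N.minId_succ_le_self t _).trans ih
  | cons hadj p ih =>
    rw [SimpleGraph.Walk.length_cons] at h
    obtain ⟨t, rfl⟩ : ∃ t', t = t' + 1 := ⟨t - 1, by omega⟩
    exact (N.minId_succ_le_of_adj t hadj).trans (ih (by omega))

theorem IsLocalMin.eq_of_dist_le {L : ℕ} {v u : V} (hv : N.IsLocalMin L v) (hu : N.IsLocalMin L u)
    (h : N.graph.dist v u ≤ L) : v = u := by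
  obtain ⟨p, hp⟩ := N.connected.exists_walk_length_eq_dist v u
  apply N.id_injective
  apply le_antisymm
  · rw [← hv]
    exact N.minId_le_of_walk p (by omega)
  · rw [← hu]
    exact N.minId_le_of_walk p.reverse (by rw [SimpleGraph.Walk.length_reverse]; omega)

theorem exists_isLocalMin (L : ℕ) : ∃ v, N.IsLocalMin L v := by
  have : Nonempty V := N.connected.nonempty
  obtain ⟨v, hv⟩ := Nat.sInf_mem (Set.range_nonempty N.id)
  refine ⟨v, le_antisymm (N.minId_le_of_walk SimpleGraph.Walk.nil (Nat.zero_le L)) ?_⟩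
  obtain ⟨u, hu⟩ := N.exists_minId_eq L v
  rw [hu, hv]
  exact Nat.sInf_le ⟨u, rfl⟩

/-- The distance to the nearest local minimum. -/
noncomputable def rootDist (L : ℕ) (v : V) : ℕ :=
  sInf {k | ∃ ρ, N.IsLocalMin L ρ ∧ N.graph.dist v ρ = k}

theorem exists_dist_eq_rootDist (L : ℕ) (v : V) :
    ∃ ρ, N.IsLocalMin L ρ ∧ N.graph.dist v ρ = N.rootDist L v := by
  obtain ⟨ρ, hρ⟩ := N.exists_isLocalMin L
  exact Nat.sInf_mem (s := {k | ∃ ρ, N.IsLocalMin L ρ ∧ N.graph.dist v ρ = k}) ⟨_, ρ, hρ, rfl⟩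

theorem rootDist_le {L : ℕ} {ρ : V} (h : N.IsLocalMin L ρ) (v : V) :
    N.rootDist L v ≤ N.graph.dist v ρ :=
  Nat.sInf_le ⟨ρ, h, rfl⟩

theorem rootDist_eq_zero_iff {L : ℕ} {v : V} : N.rootDist L v = 0 ↔ N.IsLocalMin L v := by
  constructor
  · intro h
    obtain ⟨ρ, hρ, e⟩ := N.exists_dist_eq_rootDist L v
    rw [h, N.connected.dist_eq_zero_iff] at e
    exact e ▸ hρ
  · intro h
    have := N.rootDist_le h v
    rw [SimpleGraph.dist_self] at this
    omega

theorem rootDist_le_of_adj (L : ℕ) {v u : V} (h : N.graph.Adj v u) :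
    N.rootDist L v ≤ N.rootDist L u + 1 := by
  obtain ⟨ρ, hρ, e⟩ := N.exists_dist_eq_rootDist L u
  have h1 := N.rootDist_le hρ v
  have h2 := N.connected.dist_triangle (u := v) (v := u) (w := ρ)
  rw [SimpleGraph.dist_eq_one_iff_adj.2 h] at h2
  omega

theorem exists_adj_rootDist {L : ℕ} {v : V} (h : ¬ N.IsLocalMin L v) :
    ∃ u, N.graph.Adj v u ∧ N.rootDist L u + 1 = N.rootDist L v := by
  obtain ⟨ρ, hρ, e⟩ := N.exists_dist_eq_rootDist L v
  obtain ⟨p, hp⟩ := N.connected.exists_walk_length_eq_dist v ρ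
  cases p with
  | nil => exact absurd hρ h
  | cons hadj p =>
    rename_i u
    refine ⟨u, hadj, ?_⟩
    have h1 := N.rootDist_le hρ u
    have h2 := SimpleGraph.dist_le p
    have h3 := N.rootDist_le_of_adj L hadj
    rw [SimpleGraph.Walk.length_cons] at hp
    omega

/-- The identifier of the parent of a node that is not a local minimum. -/
noncomputable def parId (L : ℕ) (v : V) : ℕ :=
  sInf {i | ∃ u, N.graph.Adj v u ∧ N.rootDist L u + 1 = N.rootDist L v ∧ N.id u = i}

theorem exists_par {L : ℕ} {v : V} (h : ¬ N.IsLocalMin L v) :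
    ∃ u, N.graph.Adj v u ∧ N.rootDist L u + 1 = N.rootDist L v ∧ N.id u = N.parId L v := by
  obtain ⟨u, h1, h2⟩ := N.exists_adj_rootDist h
  exact Nat.sInf_mem (s := {i | ∃ u, N.graph.Adj v u ∧ N.rootDist L u + 1 = N.rootDist L v ∧
    N.id u = i}) ⟨_, u, h1, h2, rfl⟩

open Classical in
/-- The breadth-first search forest whose roots are the local minima. -/
noncomputable def bfsForest (L : ℕ) : Forest N where
  IsRoot := N.IsLocalMin L
  par v := if h : N.IsLocalMin L v then v else (N.exists_par h).choose
  depth := N.rootDist L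
  adj_par v h := by
    rw [dif_neg h]
    exact (N.exists_par h).choose_spec.1
  depth_par v h := by
    rw [dif_neg h]
    exact (N.exists_par h).choose_spec.2.1

theorem id_bfsForest_par {L : ℕ} {v : V} (h : ¬ N.IsLocalMin L v) :
    N.id ((N.bfsForest L).par v) = N.parId L v := by
  simp only [bfsForest, dif_neg h]
  exact (N.exists_par h).choose_spec.2.2

/-- With all channels equal to `0`, the groups are the trees of the forest. -/
theorem exists_root (L : ℕ) (v : V) : ∃ ρ, N.IsLocalMin L ρ ∧
    (N.bfsForest L).top (fun _ _ => 0) v = (ρ, 0) := by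
  rcases Forest.top_cases (Fo := N.bfsForest L) (ch := fun _ _ => 0) v with
    ⟨ρ, h1, -, h3⟩ | ⟨y, c, -, h2, -⟩
  · exact ⟨ρ, h1, h3⟩
  · exact absurd rfl h2

theorem dist_root_le (L : ℕ) (v : V) :
    N.graph.dist v ((N.bfsForest L).top (fun _ _ => 0) v).1 ≤ N.rootDist L v := by
  induction v using Forest.depth_induction (Fo := N.bfsForest L) with
  | hroot v h =>
    rw [Forest.top_root h, SimpleGraph.dist_self]
    exact Nat.zero_le _
  | hstep v h ih =>
    rw [Forest.top_of_not_root h, Forest.chanTop_zero]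
    have h1 := (N.bfsForest L).depth_par v h
    have h2 := N.connected.dist_triangle (u := v) (v := (N.bfsForest L).par v)
      (w := ((N.bfsForest L).top (fun _ _ => 0) ((N.bfsForest L).par v)).1)
    rw [SimpleGraph.dist_eq_one_iff_adj.2 ((N.bfsForest L).adj_par v h)] at h2
    change N.rootDist L _ + 1 = N.rootDist L v at h1
    omega

/-- The path from `v` to its root has `rootDist + 1` nodes, all in the same tree and none farther
from the roots than `v`. -/
theorem rootDist_lt_ncard [Finite V] (L : ℕ) (v : V) :
    N.rootDist L v < {u | (N.bfsForest L).top (fun _ _ => 0) u =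
      (N.bfsForest L).top (fun _ _ => 0) v ∧ N.rootDist L u ≤ N.rootDist L v}.ncard := by
  induction v using Forest.depth_induction (Fo := N.bfsForest L) with
  | hroot v h =>
    rw [N.rootDist_eq_zero_iff.2 h]
    exact (Set.ncard_pos (Set.toFinite _)).2 ⟨v, rfl, by rw [N.rootDist_eq_zero_iff.2 h]⟩
  | hstep v h ih =>
    have h1 : N.rootDist L ((N.bfsForest L).par v) + 1 = N.rootDist L v :=
      (N.bfsForest L).depth_par v h
    have h2 : (N.bfsForest L).top (fun _ _ => 0) v =
        (N.bfsForest L).top (fun _ _ => 0) ((N.bfsForest L).par v) := by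
      rw [Forest.top_of_not_root h, Forest.chanTop_zero]
    rw [← h1]
    refine Nat.lt_of_le_of_lt ih (Set.ncard_lt_ncard ⟨?_, ?_⟩ (Set.toFinite _))
    · rintro x ⟨hx, hx'⟩
      exact ⟨hx.trans h2.symm, by omega⟩
    · intro hs
      have := (hs ⟨rfl, by omega⟩ : v ∈ _).2
      omega

/-- A tree of the breadth-first search forest with at most `s` nodes is the whole network. -/
theorem lt_ncard_tree [Finite V] {s L : ℕ} (hL : 2 * s ≤ L) (hV : s < Nat.card V) {ρ : V}
    (hρ : N.IsLocalMin L ρ) :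
    s < {u | (N.bfsForest L).top (fun _ _ => 0) u = (ρ, 0)}.ncard := by
  by_contra! hle
  have hdepth : ∀ u, (N.bfsForest L).top (fun _ _ => 0) u = (ρ, 0) → N.rootDist L u < s := by
    intro u hu
    refine (N.rootDist_lt_ncard L u).trans_le
      ((Set.ncard_le_ncard (fun x hx => ?_) (Set.toFinite _)).trans hle)
    exact hx.1.trans hu
  -- The tree is closed under adjacency. If `a` is adjacent to `c` in the tree, then the root of `a`
  -- is within `s` of `a`, and `c` is within `s - 1` of `ρ`; so the two roots are within `2 * s ≤ L`
  -- of each other and coincide.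
  have hall : ∀ w, (N.bfsForest L).top (fun _ _ => 0) w = (ρ, 0) := by
    intro w
    obtain ⟨p⟩ := N.connected.preconnected w ρ
    induction p with
    | nil => exact Forest.top_root (Fo := N.bfsForest L) hρ
    | cons hadj p ih =>
      rename_i a c d
      have hc := ih hρ hle hdepth
      have h1 := hdepth _ hc
      have h2 := N.rootDist_le_of_adj L hadj
      obtain ⟨ρ', hρ', e⟩ := N.exists_root L a
      have h3 := N.dist_root_le L a
      have h4 := N.dist_root_le L c
      rw [e] at h3
      rw [hc] at h4
      have h5 := N.connected.dist_triangle (u := ρ') (v := a) (w := d)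
      have h6 := N.connected.dist_triangle (u := a) (v := c) (w := d)
      rw [SimpleGraph.dist_comm] at h3
      rw [SimpleGraph.dist_eq_one_iff_adj.2 hadj] at h6
      rw [e, IsLocalMin.eq_of_dist_le N hρ' hρ (by dsimp only at *; omega)]
  have : {u | (N.bfsForest L).top (fun _ _ => 0) u = (ρ, 0)} = Set.univ :=
    Set.eq_univ_of_forall hall
  rw [this, Set.ncard_univ] at hle
  omega

/-- Without a connector the root's group would be its whole tree, which has more than `s` nodes,
whereas a remainder has at most `s`. -/
theorem exists_connector [Finite V] {s L : ℕ} (hs : 0 < s) (hL : 2 * s ≤ L) (hV : s < Nat.card V)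
    {ρ : V} (hρ : N.IsLocalMin L ρ) :
    ∃ y, (N.bfsForest L).top ((N.bfsForest L).chunkCh s) y = (ρ, 0) ∧
      (N.bfsForest L).IsConnector s y := by
  by_contra! hno
  have hsub : ∀ u, (N.bfsForest L).top (fun _ _ => 0) u = (ρ, 0) →
      (N.bfsForest L).top ((N.bfsForest L).chunkCh s) u = (ρ, 0) := by
    intro u
    induction u using Forest.depth_induction (Fo := N.bfsForest L) with
    | hroot v h =>
      rw [Forest.top_root h, Forest.top_root h]
      exact fun h => h
    | hstep v h ih =>
      rw [Forest.top_of_not_root h, Forest.top_of_not_root h, Forest.chanTop_zero]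
      intro hv
      have hp := ih hv
      have h0 : (N.bfsForest L).chunkCh s ((N.bfsForest L).par v) v = 0 := by
        by_contra h0
        exact hno _ hp ⟨_, ⟨v, ⟨h, rfl⟩, rfl⟩, h0⟩
      rw [h0, Forest.chanTop_zero, hp]
  have h1 := N.lt_ncard_tree hL hV hρ
  have h2 := Forest.ncard_top_zero_le (Fo := N.bfsForest L) hs ρ
  have h3 := Set.ncard_le_ncard (s := {u | (N.bfsForest L).top (fun _ _ => 0) u = (ρ, 0)})
    (t := {u | (N.bfsForest L).top ((N.bfsForest L).chunkCh s) u = (ρ, 0)}) hsub (Set.toFinite _)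
  omega

end Network

/-! ### Minima of residues in a short window. -/

section CyclicMin

variable {M : ℕ}

open Classical in
/-- An element of `X` from which all elements of `X` are reached by at most `W` increments. -/
noncomputable def cyclicMin (W : ℕ) (X : Set (ZMod M)) : Option (ZMod M) :=
  if h : ∃ y ∈ X, ∀ x ∈ X, ∃ a ≤ W, x = y + (a : ZMod M) then some h.choose else none

theorem cyclicMin_mem {W : ℕ} {X : Set (ZMod M)} {y : ZMod M} (h : cyclicMin W X = some y) :
    y ∈ X := by
  unfold cyclicMin at h
  split_ifs at h with hX
  exact Option.some.inj h ▸ hX.choose_spec.1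

/-- If `d` and `y` both qualify, they differ by `a` increments one way and `c` the other way; then
`M` divides `a + c ≤ 2 * W < M`, which forces `a = c = 0`. -/
theorem cyclicMin_eq {W : ℕ} (hM : 2 * W < M) {X : Set (ZMod M)} {d : ZMod M} (hd : d ∈ X)
    (hX : ∀ x ∈ X, ∃ a ≤ W, x = d + (a : ZMod M)) : cyclicMin W X = some d := by
  have h : ∃ y ∈ X, ∀ x ∈ X, ∃ a ≤ W, x = y + (a : ZMod M) := ⟨d, hd, hX⟩
  rw [cyclicMin, dif_pos h]
  obtain ⟨h1, h2⟩ := h.choose_spec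
  obtain ⟨a, ha, e⟩ := hX _ h1
  obtain ⟨c, hc, e'⟩ := h2 d hd
  have h3 : ((a + c : ℕ) : ZMod M) = 0 := by
    have : d = d + (a : ZMod M) + (c : ZMod M) := by rw [← e, ← e']
    push_cast
    linear_combination -this
  have h4 : a + c = 0 := Nat.eq_zero_of_dvd_of_lt ((ZMod.natCast_eq_zero_iff _ _).1 h3) (by omega)
  have h5 : a = 0 := by omega
  rw [e, h5]
  simp

end CyclicMin

/-! ### Recovery of erased distances and weights. -/

section Healing

variable {V : Type} (N : Network V) {M : ℕ}

/-- Estimates of the distances modulo `M`, from initial estimates `e`. -/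
noncomputable def distEst (W : ℕ) (e : V → Option (ZMod M)) : ℕ → V → Option (ZMod M)
  | 0, v => e v
  | t + 1, v => cyclicMin W ({y | distEst W e t v = some y} ∪
      {y | ∃ i z, (i, some z) ∈ N.nbrData v (distEst W e t) ∧ y = z + 1})

variable {N}

/-- Estimates never fall below the true distance, so a correct candidate wins once it is present. An
incorrect node nearest to the roots has a correct neighbor one step closer and is repaired, so the
at most `F` incorrect nodes vanish within `F` steps. -/
theorem distEst_eq [Finite V] {L F : ℕ} (hM : 4 * F < M) {e : V → Option (ZMod M)} {E : Set V}
    (hE : E.ncard ≤ F) (hroot : ∀ v ∈ E, ¬ N.IsLocalMin L v)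
    (he : ∀ v ∈ E, e v = none) (he' : ∀ v ∉ E, e v = some (N.rootDist L v : ZMod M)) (v : V) :
    distEst N (2 * F) e F v = some (N.rootDist L v : ZMod M) := by
  -- The excess grows by at most `2` per step, since adjacent nodes differ in distance by at most
  -- one. Up to step `F` all candidates thus lie in the window `2 * F`.
  have inv : ∀ t v y, distEst N (2 * F) e t v = some y →
      ∃ a ≤ 2 * t, y = (N.rootDist L v : ZMod M) + (a : ZMod M) := by
    intro t
    induction t with
    | zero =>
      intro v y h
      by_cases hv : v ∈ E
      · exact absurd ((he v hv).symm.trans h) (by simp)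
      · refine ⟨0, le_rfl, ?_⟩
        have := Option.some.inj ((he' v hv).symm.trans h)
        simp [← this]
    | succ t ih =>
      intro v y h
      rcases cyclicMin_mem h with h | ⟨i, z, ⟨u, hu, hz⟩, rfl⟩
      · obtain ⟨a, ha, rfl⟩ := ih v y h
        exact ⟨a, by omega, rfl⟩
      · obtain ⟨a, ha, rfl⟩ := ih u z (Prod.mk.inj hz).2.symm
        have h1 := N.rootDist_le_of_adj L hu
        have h2 := N.rootDist_le_of_adj L hu.symm
        refine ⟨a + (N.rootDist L u + 1 - N.rootDist L v), by omega, ?_⟩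
        have : (N.rootDist L v) + (a + (N.rootDist L u + 1 - N.rootDist L v)) =
          N.rootDist L u + a + 1 := by omega
        exact_mod_cast congrArg (Nat.cast (R := ZMod M)) this.symm
  have exact_of_mem : ∀ t < F, ∀ v, (N.rootDist L v : ZMod M) ∈
      ({y | distEst N (2 * F) e t v = some y} ∪
      {y | ∃ i z, (i, some z) ∈ N.nbrData v (distEst N (2 * F) e t) ∧ y = z + 1} : Set (ZMod M)) →
      distEst N (2 * F) e (t + 1) v = some (N.rootDist L v : ZMod M) := by
    intro t ht v hv
    refine cyclicMin_eq (by omega) hv ?_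
    rintro y (h | ⟨i, z, ⟨u, hu, hz⟩, rfl⟩)
    · obtain ⟨a, ha, rfl⟩ := inv t v y h
      exact ⟨a, by omega, rfl⟩
    · obtain ⟨a, ha, rfl⟩ := inv t u z (Prod.mk.inj hz).2.symm
      have h1 := N.rootDist_le_of_adj L hu
      have h2 := N.rootDist_le_of_adj L hu.symm
      refine ⟨a + (N.rootDist L u + 1 - N.rootDist L v), by omega, ?_⟩
      have : (N.rootDist L v) + (a + (N.rootDist L u + 1 - N.rootDist L v)) =
        N.rootDist L u + a + 1 := by omega
      exact_mod_cast congrArg (Nat.cast (R := ZMod M)) this.symm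
  have hmono : ∀ t < F, {v | distEst N (2 * F) e (t + 1) v ≠ some (N.rootDist L v : ZMod M)} ⊆
      {v | distEst N (2 * F) e t v ≠ some (N.rootDist L v : ZMod M)} :=
    fun t ht v hv h => hv (exact_of_mem t ht v (Or.inl h))
  have h0 : {v | distEst N (2 * F) e 0 v ≠ some (N.rootDist L v : ZMod M)} ⊆ E := by
    intro v hv
    by_contra h
    exact hv (he' v h)
  have hsub : ∀ t ≤ F, {v | distEst N (2 * F) e t v ≠ some (N.rootDist L v : ZMod M)} ⊆ E := by
    intro t
    induction t with
    | zero => exact fun _ => h0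
    | succ t ih => exact fun ht => (hmono t ht).trans (ih (by omega))
  have key := eq_empty_of_strict_decrease (F := F)
    (U := fun t => {v | distEst N (2 * F) e t v ≠ some (N.rootDist L v : ZMod M)})
    (Set.toFinite _) ((Set.ncard_le_ncard h0 (Set.toFinite _)).trans hE) hmono ?_
  · by_contra h
    have : v ∈ (∅ : Set V) := key ▸ h
    exact this
  · intro t ht hne
    obtain ⟨v, hv, hmin⟩ := Set.exists_min_image _ (N.rootDist L) (Set.toFinite _) hne
    refine ⟨v, hv, fun h => h (exact_of_mem t ht v (Or.inr ?_))⟩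
    obtain ⟨u, hu, hd⟩ := N.exists_adj_rootDist (hroot v (hsub t ht.le hv))
    have hu' : distEst N (2 * F) e t u = some (N.rootDist L u : ZMod M) := by
      by_contra hcon
      have := hmin u hcon
      omega
    exact ⟨N.id u, _, ⟨u, hu, by rw [hu']⟩, by rw [← hd]; push_cast; rfl⟩

variable (N) in
open Classical in
/-- The known weights, from initially known weights `e` and the identifiers `C` of the children. -/
noncomputable def weightEst (s : ℕ) (C : V → Set ℕ) (e : V → Option ℕ) : ℕ → V → Option ℕ
  | 0, v => e v
  | t + 1, v =>
    if (weightEst s C e t v).isSome then weightEst s C e t v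
    else if ∀ i ∈ C v, ∃ w, (i, some w) ∈ N.nbrData v (weightEst s C e t) then
      some (weightOf s {p | p.1 ∈ C v ∧ (p.1, some p.2) ∈ N.nbrData v (weightEst s C e t)})
    else none

/-- No wrong weight is ever produced, as a node waits for all its children. A deepest node without a
weight has only informed children, so each step informs at least one more node. -/
theorem weightEst_eq [Finite V] {Fo : Forest N} {s F : ℕ} {C : V → Set ℕ}
    (hC : ∀ v, C v = {i | ∃ c, Fo.IsChild c v ∧ i = N.id c}) {e : V → Option ℕ} {E : Set V}
    (hE : E.ncard ≤ F) (he : ∀ v ∈ E, e v = none) (he' : ∀ v ∉ E, e v = some (Fo.weight s v)) :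
    (∀ t v, weightEst N s C e t v = none ∨ weightEst N s C e t v = some (Fo.weight s v)) ∧
      ∀ v, weightEst N s C e F v = some (Fo.weight s v) := by
  have hdata : ∀ (f : V → Option ℕ) (v : V), (∀ c, Fo.IsChild c v → f c = some (Fo.weight s c)) →
      {p : ℕ × ℕ | p.1 ∈ C v ∧ (p.1, some p.2) ∈ N.nbrData v f} = Fo.childData s v := by
    intro f v hf
    ext ⟨i, w⟩
    rw [hC v]
    constructor
    · rintro ⟨⟨c, hc, rfl⟩, u, hu, hp⟩
      obtain ⟨h1, h2⟩ := Prod.mk.inj hp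
      obtain rfl := N.id_injective h1
      exact ⟨c, hc, Prod.ext rfl (Option.some.inj (h2.trans (hf c hc)))⟩
    · rintro ⟨c, hc, hp⟩
      obtain ⟨rfl, rfl⟩ := Prod.mk.inj hp
      exact ⟨⟨c, hc, rfl⟩, c, hc.adj, by rw [hf c hc]⟩
  have inv : ∀ t v, weightEst N s C e t v = none ∨
      weightEst N s C e t v = some (Fo.weight s v) := by
    intro t
    induction t with
    | zero =>
      intro v
      by_cases hv : v ∈ E
      · exact Or.inl (he v hv)
      · exact Or.inr (he' v hv)
    | succ t ih =>
      intro v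
      rw [weightEst]
      split_ifs with h1 h2
      · exact ih v
      · right
        rw [hdata, ← Fo.weight_eq]
        intro c hc
        obtain ⟨w, u, hu, hp⟩ := h2 (N.id c) (by rw [hC v]; exact ⟨c, hc, rfl⟩)
        obtain ⟨h3, h4⟩ := Prod.mk.inj hp
        obtain rfl := N.id_injective h3
        rcases ih c with h | h
        · exact absurd (h4.trans h) (by simp)
        · exact h
      · exact Or.inl rfl
  refine ⟨inv, fun v => ?_⟩
  have h0 : {v | weightEst N s C e 0 v ≠ some (Fo.weight s v)} ⊆ E := by
    intro v hv
    by_contra h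
    exact hv (he' v h)
  have key := eq_empty_of_strict_decrease (F := F)
    (U := fun t => {v | weightEst N s C e t v ≠ some (Fo.weight s v)})
    (Set.toFinite _) ((Set.ncard_le_ncard h0 (Set.toFinite _)).trans hE) ?_ ?_
  · by_contra h
    have : v ∈ (∅ : Set V) := key ▸ h
    exact this
  · intro t _ v hv h
    apply hv
    rw [weightEst, h]
    rfl
  · intro t _ hne
    obtain ⟨v, hv, hmax⟩ := Set.exists_max_image _ Fo.depth (Set.toFinite _) hne
    refine ⟨v, hv, fun h => h ?_⟩
    have hch : ∀ c, Fo.IsChild c v → weightEst N s C e t c = some (Fo.weight s c) := by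
      intro c hc
      by_contra hcon
      have := hmax c hcon
      rw [hc.depth] at this
      omega
    have hnone : weightEst N s C e t v = none := (inv t v).resolve_right hv
    rw [weightEst, hnone, if_neg (by simp), if_pos, hdata _ v hch, ← Fo.weight_eq]
    rw [hC v]
    rintro i ⟨c, hc, rfl⟩
    exact ⟨_, c, hc.adj, by rw [hch c hc]⟩

end Healing

/-! ### Distributed computation of the forest and its groups. -/

namespace Known

variable {J : Type 1} {I α : Type} {V : J → Type} {b : ℕ} {N : ∀ i, Network (V i)}
  {x : ∀ i, V i → I} {T : ℕ} {X : ∀ i, V i → α} {m B : ℕ}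

theorem minId (h : Known b N x T X) (hm : 0 < m) (hB : B ≤ 2 ^ (m * b))
    (hid : ∀ i v, (N i).id v < B) (idf : α → ℕ) (hidf : ∀ i v, idf (X i v) = (N i).id v) (L : ℕ) :
    Known b N x (T + m * L) (fun i v => (X i v, (N i).minId L v)) := by
  refine Known.iterate (α := α × ℕ) hm (fun a _ => a.2) (S := {j | j < B}) (Set.finite_lt_nat B)
    ?_ (fun a inb => (a.1, sInf ({a.2} ∪ {y | ∃ i, (i, y) ∈ inb})))
    (fun t i v => (X i v, (N i).minId t v)) ?_ ?_ ?_ L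
  · rwa [show {j | j < B} = ((Finset.range B : Finset ℕ) : Set ℕ) by ext; simp,
      Set.ncard_coe_finset, Finset.card_range]
  · exact (h.map fun a => (a, idf a)).congr fun i v => by rw [hidf]; rfl
  · intro t i v u _
    obtain ⟨w, hw⟩ := (N i).exists_minId_eq t u
    show (N i).minId t u < B
    rw [hw]
    exact hid i w
  · intro t i v
    rfl

theorem rootDist [∀ i, Finite (V i)] (h : Known b N x T X) (hm : 0 < m) {L F M : ℕ}
    (hM : 4 * F < M) (hcap : M + 1 ≤ 2 ^ (m * b)) (est : α → Option (ZMod M)) (E : ∀ i, Set (V i))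
    (hE : ∀ i, (E i).ncard ≤ F) (hroot : ∀ i, ∀ v ∈ E i, ¬ (N i).IsLocalMin L v)
    (hest : ∀ i, ∀ v ∈ E i, est (X i v) = none)
    (hest' : ∀ i, ∀ v ∉ E i, est (X i v) = some ((N i).rootDist L v : ZMod M)) :
    Known b N x (T + m * F) (fun i v => (X i v, ((N i).rootDist L v : ZMod M))) := by
  have : NeZero M := ⟨by omega⟩
  have hit := Known.iterate (N := N) (b := b) (x := x) (T := T)
    (α := α × Option (ZMod M)) hm (fun a _ => a.2) (S := Set.univ) Set.finite_univ
    (by rw [Set.ncard_univ, Nat.card_eq_fintype_card, Fintype.card_option, ZMod.card]; exact hcap)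
    (fun a inb => (a.1, cyclicMin (2 * F) ({y | a.2 = some y} ∪
      {y | ∃ i z, (i, some z) ∈ inb ∧ y = z + 1})))
    (fun t i v => (X i v, distEst (N i) (2 * F) (fun u => est (X i u)) t v))
    (h.map fun a => (a, est a)) (fun _ _ _ _ _ => Set.mem_univ _) (fun _ _ _ => rfl) F
  refine (hit.map fun a => (a.1, a.2.getD 0)).congr fun i v => ?_
  rw [distEst_eq hM (hE i) (hroot i) (hest i) (hest' i)]
  rfl

/-- Along an edge `rootDist u + 1 - rootDist v` is `0`, `1` or `2`, which residues modulo `M > 2`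
tell apart. -/
theorem natCast_rootDist_eq_iff {V : Type} {N : Network V} {M L : ℕ} (hM : 2 < M) {v u : V}
    (h : N.graph.Adj v u) : (N.rootDist L u : ZMod M) + 1 = (N.rootDist L v : ZMod M) ↔
      N.rootDist L u + 1 = N.rootDist L v := by
  constructor
  · intro e
    have h1 := N.rootDist_le_of_adj L h
    have h2 := N.rootDist_le_of_adj L h.symm
    have e' : ((N.rootDist L u + 1 - N.rootDist L v : ℕ) : ZMod M) = 0 := by
      rw [Nat.cast_sub h1]
      push_cast
      rw [e, sub_self]
    have := Nat.eq_zero_of_dvd_of_lt ((ZMod.natCast_eq_zero_iff _ _).1 e') (by omega)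
    omega
  · intro e
    rw [← e]
    push_cast
    rfl

open Classical in
theorem parent (h : Known b N x T X) (hm : 0 < m) {L M : ℕ} (hM : 2 < M)
    (hcap : M ≤ 2 ^ (m * b)) (dist : α → ZMod M) (root : α → Prop)
    (hdist : ∀ i v, dist (X i v) = ((N i).rootDist L v : ZMod M))
    (hroot : ∀ i v, root (X i v) ↔ (N i).IsLocalMin L v) :
    Known b N x (T + m) (fun i v => (X i v, (((N i).bfsForest L).localView (fun _ _ => 0) v).1)) := by
  have : NeZero M := ⟨by omega⟩
  have hex := h.exchange (M := ZMod M) hm (fun a _ => dist a) (S := Set.univ) Set.finite_univ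
    (by rw [Set.ncard_univ, Nat.card_eq_fintype_card, ZMod.card]; exact hcap)
    (fun _ _ _ _ => Set.mem_univ _)
  refine (hex.map fun a => (a.1, if root a.1 then none else
    some (sInf {i | ∃ z, (i, z) ∈ a.2 ∧ z + 1 = dist a.1}))).congr fun i v => ?_
  simp only [Prod.mk.injEq, true_and, Forest.localView, hroot, hdist]
  by_cases hr : (N i).IsLocalMin L v
  · rw [if_pos hr, if_pos (show ((N i).bfsForest L).IsRoot v from hr)]
  · rw [if_neg hr, if_neg (show ¬ ((N i).bfsForest L).IsRoot v from hr),
      (N i).id_bfsForest_par hr, Network.parId]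
    congr 2
    ext j
    constructor
    · rintro ⟨z, ⟨u, hu, e⟩, hz⟩
      obtain ⟨rfl, rfl⟩ := Prod.mk.inj e
      exact ⟨u, hu, (natCast_rootDist_eq_iff hM hu).1 hz, rfl⟩
    · rintro ⟨u, hu, hd, rfl⟩
      exact ⟨_, ⟨u, hu, rfl⟩, (natCast_rootDist_eq_iff hM hu).2 hd⟩

theorem ncard_option_lt_le {P : Type} [Fintype P] (B : ℕ) :
    ({none} ∪ some '' {y | y.1 < B} : Set (Option (ℕ × P))).Finite ∧
      ({none} ∪ some '' {y | y.1 < B} : Set (Option (ℕ × P))).ncard ≤ B * Fintype.card P + 1 := by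
  have e : {y : ℕ × P | y.1 < B} =
      ((Finset.range B ×ˢ (Finset.univ : Finset P) : Finset (ℕ × P)) : Set (ℕ × P)) := by
    ext y
    simp
  rw [e]
  refine ⟨(Set.finite_singleton _).union ((Finset.finite_toSet _).image _), ?_⟩
  refine (Set.ncard_union_le _ _).trans ?_
  rw [Set.ncard_singleton, add_comm, Set.ncard_image_of_injective _ (Option.some_injective _),
    Set.ncard_coe_finset, Finset.card_product, Finset.card_range, Finset.card_univ]

/-- Every node announces its parent's identifier to all neighbors; the children are the neighbors
that announce the receiver's own. -/
theorem children (h : Known b N x T X) (hm : 0 < m) (hB : B + 1 ≤ 2 ^ (m * b))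
    (hid : ∀ i v, (N i).id v < B) (Fo : ∀ i, Forest (N i)) (idf : α → ℕ)
    (hidf : ∀ i v, idf (X i v) = (N i).id v) (po : α → Option ℕ)
    (hpo : ∀ i v, po (X i v) = ((Fo i).localView (fun _ _ => 0) v).1) :
    Known b N x (T + m)
      (fun i v => (X i v, {j | ∃ c, (Fo i).IsChild c v ∧ j = (N i).id c})) := by
  classical
  obtain ⟨hfin, hcard⟩ := ncard_option_lt_le (P := Unit) B
  have hex := h.exchange hm (fun a _ => (po a).map fun j => (j, ())) hfin
    (hcard.trans (by simpa using hB)) ?_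
  · refine (hex.map fun a => (a.1, {j | (j, some (idf a.1, ())) ∈ a.2})).congr fun i v => ?_
    simp only [Prod.mk.injEq, true_and, hidf]
    ext j
    constructor
    · rintro ⟨u, hu, e⟩
      obtain ⟨rfl, e⟩ := Prod.mk.inj e
      simp only [hpo, Forest.localView] at e
      split_ifs at e with hr
      · simp at e
      · simp only [Option.map_some, Option.some.injEq, Prod.mk.injEq, and_true] at e
        exact ⟨u, ⟨hr, ((N i).id_injective e.2).symm⟩, rfl⟩
    · rintro ⟨c, hc, rfl⟩
      refine ⟨c, hc.adj, ?_⟩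
      simp only [hpo, Forest.localView, if_neg hc.1, Option.map_some, hc.2]
  · intro i v u _
    simp only [hpo, Forest.localView]
    split_ifs
    · exact Or.inl rfl
    · exact Or.inr ⟨_, hid i _, rfl⟩

/-- The last `m` rounds, after the healing, deliver the final weights of the children. -/
theorem childData [∀ i, Finite (V i)] (h : Known b N x T X) (hm : 0 < m) {s F : ℕ} (hs : 0 < s)
    (hcap : s + 2 ≤ 2 ^ (m * b)) (Fo : ∀ i, Forest (N i)) (C : α → Set ℕ)
    (hC : ∀ i v, C (X i v) = {j | ∃ c, (Fo i).IsChild c v ∧ j = (N i).id c})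
    (est : α → Option ℕ) (E : ∀ i, Set (V i))
    (hE : ∀ i, (E i).ncard ≤ F) (hest : ∀ i, ∀ v ∈ E i, est (X i v) = none)
    (hest' : ∀ i, ∀ v ∉ E i, est (X i v) = some ((Fo i).weight s v)) :
    Known b N x (T + m * F + m) (fun i v => (X i v, (Fo i).childData s v)) := by
  classical
  have key := fun i => weightEst_eq (N := N i) (Fo := Fo i) (C := fun v => C (X i v)) (hC i)
    (e := fun v => est (X i v)) (hE i) (hest i) (hest' i)
  have hS : ({none} ∪ some '' {w | w ≤ s} : Set (Option ℕ)).Finite :=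
    (Set.finite_singleton _).union ((Set.finite_le_nat s).image _)
  have hcard : ({none} ∪ some '' {w | w ≤ s} : Set (Option ℕ)).ncard ≤ 2 ^ (m * b) := by
    refine (Set.ncard_union_le _ _).trans (le_trans ?_ hcap)
    rw [Set.ncard_singleton, Set.ncard_image_of_injective _ (Option.some_injective _),
      show {w | w ≤ s} = ((Finset.range (s + 1) : Finset ℕ) : Set ℕ) by ext; simp,
      Set.ncard_coe_finset, Finset.card_range]
    omega
  have hmem : ∀ t i v, weightEst (N i) s (fun v => C (X i v)) (fun v => est (X i v)) t v ∈
      ({none} ∪ some '' {w | w ≤ s} : Set (Option ℕ)) := by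
    intro t i v
    rcases (key i).1 t v with e | e
    · exact Or.inl e
    · exact Or.inr ⟨_, Forest.weight_le hs v, e.symm⟩
  have hit := Known.iterate (N := N) (b := b) (x := x) (T := T) (α := α × Option ℕ) hm
    (fun a _ => a.2) hS hcard
    (fun a inb => (a.1, if a.2.isSome then a.2
      else if ∀ i ∈ C a.1, ∃ w, (i, some w) ∈ inb then
        some (weightOf s {p | p.1 ∈ C a.1 ∧ (p.1, some p.2) ∈ inb}) else none))
    (fun t i v => (X i v,
      weightEst (N i) s (fun v => C (X i v)) (fun v => est (X i v)) t v))
    (h.map fun a => (a, est a)) (fun t i v u _ => hmem t i u)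
    (fun t i v => by simp only [weightEst]) F
  have hex := hit.exchange hm (fun a _ => a.2) hS hcard (fun i v u _ => hmem F i u)
  refine (hex.map fun a =>
    (a.1.1, {p : ℕ × ℕ | p.1 ∈ C a.1.1 ∧ (p.1, some p.2) ∈ a.2})).congr fun i v => ?_
  simp only [Prod.mk.injEq, true_and, (key i).2]
  rw [hC]
  ext ⟨j, w⟩
  constructor
  · rintro ⟨⟨c, hc, rfl⟩, u, hu, hp⟩
    obtain ⟨h1, h2⟩ := Prod.mk.inj hp
    obtain rfl := (N i).id_injective h1
    exact ⟨c, hc, Prod.ext rfl (Option.some.inj h2)⟩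
  · rintro ⟨c, hc, hp⟩
    obtain ⟨rfl, rfl⟩ := Prod.mk.inj hp
    exact ⟨⟨c, hc, rfl⟩, c, hc.adj, rfl⟩

/-- Every node learns its incident edges in the channels with merged root groups. -/
theorem localMerged [∀ i, Finite (V i)] (h : Known b N x T X) (hm : 0 < m) {s : ℕ} (hs : 0 < s)
    (hcap : B * 4 + 1 ≤ 2 ^ (m * b)) (hid : ∀ i v, (N i).id v < B) (Fo : ∀ i, Forest (N i))
    (idf : α → ℕ) (hidf : ∀ i v, idf (X i v) = (N i).id v) (po : α → Option ℕ)
    (hpo : ∀ i v, po (X i v) = ((Fo i).localView (fun _ _ => 0) v).1)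
    (D : α → Set (ℕ × ℕ)) (hD : ∀ i v, D (X i v) = (Fo i).childData s v) :
    Known b N x (T + m * (3 * (2 * s)))
      (fun i v => (X i v, (Fo i).localView ((Fo i).mergedCh s) v)) := by
  classical
  obtain ⟨hfin, hcard⟩ := ncard_option_lt_le (P := Prop × Prop) B
  have hroot : ∀ i v, po (X i v) = none ↔ (Fo i).IsRoot v := by
    intro i v
    rw [hpo, Forest.localView]
    by_cases hr : (Fo i).IsRoot v <;> simp [hr]
  -- A flooding of the unmerged groups whose tokens are an identifier with two flags, root and
  -- connector; this is the factor `4` in `hcap`, and it suffices to identify the star.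
  have hfl := h.flood hm Fo (fun i => (Fo i).chunkCh s)
    (fun a => (po a, {p | ∃ q ∈ D a, p = (q.1, chunk s (finOf (D a)) q)})) ?_
    (fun a => (idf a, (po a = none), ∃ q ∈ D a, chunk s (finOf (D a)) q ≠ 0)) hfin
    (hcard.trans (by simpa using hcap)) (Or.inl rfl) ?_
    (fun i => Forest.ncard_top_chunkCh_le (Fo := Fo i) hs)
  · refine (hfl.map fun a => (a.1, (po a.1, {p : ℕ × ℕ | ∃ q ∈ D a.1, p = (q.1,
      if ((∃ q ∈ D a.1, chunk s (finOf (D a.1)) q ≠ 0) ∧ (∃ y ∈ a.2, y.2.1) ∧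
        ∀ y ∈ a.2, y.2.2 → idf a.1 ≤ y.1) ∧
        chunk s (finOf (D a.1)) q = Forest.firstChunk s (D a.1) then 0
      else chunk s (finOf (D a.1)) q)}))).congr fun i v => ?_
    have hstar : ((∃ q ∈ (Fo i).childData s v, chunk s (finOf ((Fo i).childData s v)) q ≠ 0) ∧
        (∃ y ∈ {y : ℕ × Prop × Prop | ∃ u, (Fo i).top ((Fo i).chunkCh s) u =
          (Fo i).top ((Fo i).chunkCh s) v ∧ y = ((N i).id u, (Fo i).IsRoot u,
            ∃ q ∈ (Fo i).childData s u, chunk s (finOf ((Fo i).childData s u)) q ≠ 0)}, y.2.1) ∧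
        ∀ y ∈ {y : ℕ × Prop × Prop | ∃ u, (Fo i).top ((Fo i).chunkCh s) u =
          (Fo i).top ((Fo i).chunkCh s) v ∧ y = ((N i).id u, (Fo i).IsRoot u,
            ∃ q ∈ (Fo i).childData s u, chunk s (finOf ((Fo i).childData s u)) q ≠ 0)},
          y.2.2 → (N i).id v ≤ y.1) ↔ (Fo i).IsStar s v := by
      rw [Forest.IsStar]
      refine and_congr Iff.rfl (and_congr ?_ ?_)
      · constructor
        · rintro ⟨_, ⟨u, hu, rfl⟩, hr⟩
          exact ⟨u, hu, hr⟩
        · rintro ⟨u, hu, hr⟩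
          exact ⟨_, ⟨u, hu, rfl⟩, hr⟩
      · constructor
        · intro hy u hu hc
          exact hy _ ⟨u, hu, rfl⟩ hc
        · rintro hy _ ⟨u, hu, rfl⟩ hc
          exact hy u hu hc
    simp only [Prod.mk.injEq, true_and, hidf, hD, hroot, hstar, Forest.localView]
    refine ⟨by rw [hpo]; rfl, ?_⟩
    ext p
    constructor
    · rintro ⟨_, ⟨c, hc, rfl⟩, rfl⟩
      exact ⟨c, hc, rfl⟩
    · rintro ⟨c, hc, rfl⟩
      exact ⟨_, ⟨c, hc, rfl⟩, rfl⟩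
  · intro i v
    simp only [hpo, hD, Forest.localView, Prod.mk.injEq, true_and]
    ext p
    constructor
    · rintro ⟨_, ⟨c, hc, rfl⟩, rfl⟩
      exact ⟨c, hc, rfl⟩
    · rintro ⟨c, hc, rfl⟩
      exact ⟨_, ⟨c, hc, rfl⟩, rfl⟩
  · intro i v
    refine Or.inr ⟨_, ?_, rfl⟩
    show idf (X i v) < B
    rw [hidf]
    exact hid i v

end Known

/-! ### The oracle, decoding within a group, and the whole algorithm. -/

/-- A network with a labeling and a set of at most `F` erased nodes. -/
structure ErasureInstance (n k F ℓ : ℕ) : Type 1 where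
  V : Type
  finite : Finite V
  N : Network V
  card : Nat.card V = n
  id_lt : ∀ v, N.id v < n ^ k
  φ : V → BitString ℓ
  E : Set V
  card_erased : E.ncard ≤ F

/-- The content of a new label: the distance to the nearest root modulo `4 * F + 3`, the weight of
the node, its original label and a check symbol. -/
abbrev Label (F ℓ q : ℕ) : Type :=
  ZMod (4 * F + 3) × Fin (2 * F + 1) × BitString ℓ × BitString q

section Oracle

variable {V : Type} [Finite V] (N : Network V) (F : ℕ) {ℓ : ℕ}

/-- The name of the group of a node. -/
noncomputable def groupName (v : V) : V × ℕ :=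
  (N.bfsForest (4 * F)).top ((N.bfsForest (4 * F)).mergedCh (2 * F)) v

/-- The identifiers in the group of a node. -/
def groupIds (v : V) : Set ℕ := {j | ∃ u, groupName N F u = groupName N F v ∧ j = N.id u}

/-- The original labels, as a function of the identifiers. -/
noncomputable def wordOf (φ : V → BitString ℓ) : ℕ → BitString ℓ :=
  Function.extend N.id φ fun _ _ => false

/-- The new label of a node. -/
noncomputable def newLabel (q : ℕ) (φ : V → BitString ℓ) (v : V) : Label F ℓ q :=
  (((N.rootDist (4 * F) v : ℕ) : ZMod (4 * F + 3)),
    Fin.ofNat (2 * F + 1) ((N.bfsForest (4 * F)).weight (2 * F) v), φ v,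
    check ℓ q (groupIds N F v) (wordOf N φ) (N.id v))

variable {N F}

theorem groupIds_eq {u v : V} (h : groupName N F u = groupName N F v) :
    groupIds N F u = groupIds N F v := by
  simp only [groupIds, h]

theorem ncard_groupIds (v : V) :
    (groupIds N F v).ncard = {u | groupName N F u = groupName N F v}.ncard := by
  rw [← Set.ncard_image_of_injective _ N.id_injective]
  congr 1
  ext j
  constructor
  · rintro ⟨u, hu, rfl⟩
    exact ⟨u, hu, rfl⟩
  · rintro ⟨u, hu, rfl⟩
    exact ⟨u, hu, rfl⟩

open Classical in
/-- The original label of the node with identifier `i`, from the pairs of identifiers and labels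
with check symbols of its group. -/
noncomputable def decodeGroup {q : ℕ} (i : ℕ) (G : Set (ℕ × Option (BitString ℓ × BitString q))) :
    BitString ℓ :=
  Classical.epsilon (fun w : ℕ → BitString ℓ => ∀ y ∈ G, ∀ a c, y.2 = some (a, c) →
    w y.1 = a ∧ check ℓ q {j | ∃ y ∈ G, j = y.1} w y.1 = c) i

/-- The true word fits the surviving symbols, so the chosen word fits them too. At most `F` of at
least `2 * F` positions are erased, so both words agree on the group; `12 * F ≤ 2 ^ q` covers groups
of up to `6 * F` nodes. -/
theorem decodeGroup_eq {q : ℕ} (hF : 0 < F) (hℓ : ℓ ≤ q) (hq : 12 * F ≤ 2 ^ q)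
    (hV : 2 * F < Nat.card V) {E : Set V} (hE : E.ncard ≤ F) (φ : V → BitString ℓ)
    {tok : V → ℕ × Option (BitString ℓ × BitString q)} (htok : ∀ v ∈ E, tok v = (N.id v, none))
    (htok' : ∀ v ∉ E, tok v = (N.id v, some (newLabel N F q φ v).2.2)) (v : V) :
    decodeGroup (N.id v) {y | ∃ u, groupName N F u = groupName N F v ∧ y = tok u} = φ v := by
  have hid : ∀ u, (tok u).1 = N.id u := by
    intro u
    by_cases hu : u ∈ E
    · rw [htok u hu]
    · rw [htok' u hu]
  have hI : {j | ∃ y ∈ {y | ∃ u, groupName N F u = groupName N F v ∧ y = tok u}, j = y.1} =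
      groupIds N F v := by
    ext j
    constructor
    · rintro ⟨_, ⟨u, hu, rfl⟩, rfl⟩
      exact ⟨u, hu, hid u⟩
    · rintro ⟨u, hu, rfl⟩
      exact ⟨_, ⟨u, hu, rfl⟩, (hid u).symm⟩
  have hword : ∀ u, wordOf N φ (N.id u) = φ u := fun u => N.id_injective.extend_apply _ _ u
  rw [decodeGroup, hI]
  have hex : ∃ w : ℕ → BitString ℓ, ∀ y ∈ {y | ∃ u, groupName N F u = groupName N F v ∧ y = tok u},
      ∀ a c, y.2 = some (a, c) → w y.1 = a ∧ check ℓ q (groupIds N F v) w y.1 = c := by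
    refine ⟨wordOf N φ, ?_⟩
    rintro _ ⟨u, hu, rfl⟩ a c hac
    by_cases huE : u ∈ E
    · rw [htok u huE] at hac
      simp at hac
    · rw [htok' u huE] at hac ⊢
      have e := Option.some.inj hac
      simp only [newLabel, Prod.mk.injEq] at e
      rw [hword u, ← groupIds_eq hu]
      exact e
  have hw := Classical.epsilon_spec hex
  generalize Classical.epsilon (α := ℕ → BitString ℓ) _ = w at hw ⊢
  have hs : 0 < 2 * F := by omega
  have hle : (groupIds N F v).ncard ≤ 3 * (2 * F) := by
    rw [ncard_groupIds]
    exact Forest.ncard_top_mergedCh_le hs _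
  have hge : 2 * F ≤ (groupIds N F v).ncard := by
    rw [ncard_groupIds]
    exact Forest.le_ncard_top_mergedCh hs
      (fun ρ hρ => N.exists_connector hs (by omega) hV hρ) v
  have hfin : (groupIds N F v).Finite :=
    (Set.finite_range N.id).subset fun _ ⟨u, _, hu⟩ => ⟨u, hu.symm⟩
  have hq0 : q ≠ 0 := by
    rintro rfl
    omega
  have hcheck := isCheck_check (ℓ := ℓ) (q := q) hℓ hq0 hfin (by omega)
  rw [← hword v]
  refine hcheck w (wordOf N φ) (N.id '' E) ?_ ?_ (N.id v) ⟨v, rfl, rfl⟩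
  · have h1 := Set.ncard_le_ncard (Set.inter_subset_left (s := N.id '' E) (t := groupIds N F v))
      (Set.toFinite _)
    rw [Set.ncard_image_of_injective _ N.id_injective] at h1
    omega
  · rintro _ ⟨u, hu, rfl⟩ huE
    have huE : u ∉ E := fun h => huE ⟨u, h, rfl⟩
    have := hw (tok u) ⟨u, hu, rfl⟩ (φ u) (check ℓ q (groupIds N F u) (wordOf N φ) (N.id u))
      (by rw [htok' u huE]; rfl)
    rw [hid u] at this
    rw [hword u, this.1, this.2, groupIds_eq hu]
    exact ⟨rfl, rfl⟩

end Oracle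

/-- The steps of `m` rounds are `4F` for minima, `F` for distances, one each for parents and
children, `F + 1` for weights, `12F` for finding the stars and `18F` for the final flooding. The one
capacity bound `hcap` covers every message alphabet in use. -/
theorem known_labels {n k F ℓ q b m : ℕ} {I : Type} (hF : 0 < F) (hn : 4 * F + 3 < n) (hm : 0 < m)
    (hℓ : ℓ ≤ q) (hq : 12 * F ≤ 2 ^ q) (hcap : n ^ k * (2 ^ (ℓ + q) + 4) + n + 1 ≤ 2 ^ (m * b))
    (x : ∀ i : ErasureInstance n k F ℓ, i.V → I) (lab : I → Option (Label F ℓ q))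
    (hlab : ∀ i, ∀ v ∈ i.E, lab (x i v) = none)
    (hlab' : ∀ i, ∀ v ∉ i.E,
      lab (x i v) = some (@newLabel i.V i.finite i.N F ℓ q i.φ v)) :
    Known b (fun i : ErasureInstance n k F ℓ => i.N) x (m * (36 * F + 3)) (fun i v => i.φ v) := by
  classical
  have (i : ErasureInstance n k F ℓ) : Finite i.V := i.finite
  have hid : ∀ (i : ErasureInstance n k F ℓ) v, i.N.id v < n ^ k := fun i => i.id_lt
  have hmul : n ^ k * (2 ^ (ℓ + q) + 4) = n ^ k * 2 ^ (ℓ + q) + n ^ k * 4 := by ring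
  have hs : 0 < 2 * F := by omega
  have K0 := (Known.init b (fun i : ErasureInstance n k F ℓ => i.N) x).map
    fun a => (a.1, lab a.2)
  have K1 := K0.minId hm (B := n ^ k) (by omega) hid (fun a => a.1) (fun _ _ => rfl) (4 * F)
  have K2 := K1.rootDist hm (L := 4 * F) (F := F) (M := 4 * F + 3) (by omega) (by omega)
    -- A root recognizes itself and sets its distance to `0` even if its label is erased; only
    -- non-roots need healing.
    (fun a => if a.2 = a.1.1 then some 0 else a.1.2.map fun l => l.1)
    (fun i => {v | v ∈ i.E ∧ ¬ i.N.IsLocalMin (4 * F) v})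
    (fun i => (Set.ncard_le_ncard (fun v hv => hv.1) (Set.toFinite _)).trans i.card_erased)
    (fun i v hv => hv.2) ?_ ?_
  · have K3 := K2.parent hm (L := 4 * F) (by omega) (by omega) (fun a => a.2)
      (fun a => a.1.2 = a.1.1.1) (fun _ _ => rfl) (fun _ _ => Iff.rfl)
    have K4 := K3.children hm (B := n ^ k) (by omega) hid (fun i => i.N.bfsForest (4 * F))
      (fun a => a.1.1.1.1) (fun _ _ => rfl) (fun a => a.2) (fun _ _ => rfl)
    have K5 := K4.childData hm (s := 2 * F) (F := F) hs (by omega) (fun i => i.N.bfsForest (4 * F))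
      (fun a => a.2) (fun _ _ => rfl) (fun a => a.1.1.1.1.2.map fun l => (l.2.1 : ℕ))
      (fun i => i.E) (fun i => i.card_erased) ?_ ?_
    · have K6 := K5.localMerged hm hs (B := n ^ k) (by omega) hid
        (fun i => i.N.bfsForest (4 * F)) (fun a => a.1.1.1.1.1.1) (fun _ _ => rfl)
        (fun a => a.1.1.2) (fun _ _ => rfl) (fun a => a.2) (fun _ _ => rfl)
      obtain ⟨hfin, hcard⟩ :=
        Known.ncard_option_lt_le (P := Option (BitString ℓ × BitString q)) (n ^ k)
      have K7 := K6.flood hm (fun i => i.N.bfsForest (4 * F))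
        (fun i => (i.N.bfsForest (4 * F)).mergedCh (2 * F)) (fun a => a.2) (fun _ _ => rfl)
        (fun a => (a.1.1.1.1.1.1.1, a.1.1.1.1.1.1.2.map fun l => l.2.2)) hfin
        (hcard.trans (le_trans (by
          simp only [Fintype.card_option, Fintype.card_prod, Fintype.card_fun, Fintype.card_bool,
            Fintype.card_fin, ← pow_add]
          rw [mul_add]
          omega) hcap)) (Or.inl rfl) ?_
        (fun i => Forest.ncard_top_mergedCh_le (Fo := i.N.bfsForest (4 * F)) hs)
      · have K8 := K7.map fun a => decodeGroup a.1.1.1.1.1.1.1.1 a.2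
        have hT : 0 + m * (4 * F) + m * F + m + m + m * F + m + m * (3 * (2 * (2 * F))) +
            m * (3 * (3 * (2 * F))) = m * (36 * F + 3) := by ring
        rw [hT] at K8
        refine K8.congr fun i v => ?_
        refine decodeGroup_eq (N := i.N) hF hℓ hq (by rw [i.card]; omega) i.card_erased i.φ
          (tok := fun u => (i.N.id u, (lab (x i u)).map fun l => l.2.2)) ?_ ?_ v
        · intro u hu
          simp only [hlab i u hu, Option.map_none]
        · intro u hu
          simp only [hlab' i u hu, Option.map_some]
      · intro i v
        exact Or.inr ⟨_, hid i v, rfl⟩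
    · intro i v hv
      simp only [hlab i v hv, Option.map_none]
    · intro i v hv
      simp only [hlab' i v hv, Option.map_some, newLabel, Fin.val_ofNat]
      rw [Nat.mod_eq_of_lt]
      have := Forest.weight_le (Fo := i.N.bfsForest (4 * F)) hs v
      omega
  · rintro i v ⟨hv, hr⟩
    simp only [hlab i v hv, Option.map_none]
    exact if_neg hr
  · intro i v hv
    by_cases hr : i.N.IsLocalMin (4 * F) v
    · rw [i.N.rootDist_eq_zero_iff.2 hr, Nat.cast_zero]
      exact if_pos hr
    · have hv : v ∉ i.E := fun h => hv ⟨h, hr⟩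
      simp only [hlab' i v hv, Option.map_some]
      exact if_neg hr

/-! ### Parameters and the final scheme. -/

theorem lt_two_pow_log_add (F : ℕ) : F < 2 ^ (Nat.log 2 F + 1) :=
  Nat.lt_pow_succ_log_self one_lt_two F

/-- The four components need at most `2 * ℓ + 3 * log F + 12` bits, and `0 < ℓ` lets `12 * ℓ` absorb
the constant. -/
theorem card_label_le {F ℓ : ℕ} (hF : 0 < F) (hℓ : 0 < ℓ) :
    Nat.card (Label F ℓ (ℓ + Nat.log 2 F + 5)) ≤ 2 ^ (14 * ℓ + 3 * Nat.log 2 F) := by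
  have h := lt_two_pow_log_add F
  rw [Nat.card_prod, Nat.card_prod, Nat.card_prod, Nat.card_zmod, Nat.card_fin,
    Nat.card_eq_fintype_card, Nat.card_eq_fintype_card]
  simp only [Fintype.card_fun, Fintype.card_bool, Fintype.card_fin]
  have h1 : 4 * F + 3 ≤ 2 ^ (Nat.log 2 F + 4) := by
    rw [show Nat.log 2 F + 4 = Nat.log 2 F + 1 + 3 by ring, pow_add]
    omega
  have h2 : 2 * F + 1 ≤ 2 ^ (Nat.log 2 F + 3) := by
    rw [show Nat.log 2 F + 3 = Nat.log 2 F + 1 + 2 by ring, pow_add]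
    omega
  calc _ ≤ 2 ^ (Nat.log 2 F + 4) * (2 ^ (Nat.log 2 F + 3) *
      (2 ^ ℓ * 2 ^ (ℓ + Nat.log 2 F + 5))) := by gcongr
    _ = 2 ^ (2 * ℓ + 3 * Nat.log 2 F + 12) := by
      rw [← pow_add, ← pow_add, ← pow_add]
      congr 1
      ring
    _ ≤ _ := Nat.pow_le_pow_right two_pos (by omega)

/-- With `g` for the rounded-down logarithm of `n`, `2 * ℓ / g + 1` of the blocks already pay for `2
* ℓ` bits. The extra block pays `2 * g * k` bits for an identifier and `4 * g` for the lower-order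
terms. -/
theorem capacity_le {n k F ℓ : ℕ} (hF : 0 < F) (hn : 80 * F < n) :
    n ^ k * (2 ^ (ℓ + (ℓ + Nat.log 2 F + 5)) + 4) + n + 1 ≤
      2 ^ ((2 * ℓ / Nat.log 2 n + 2) * ((2 * k + 4) * Nat.log 2 n)) := by
  have hlog : Nat.log 2 F ≤ Nat.log 2 n := Nat.log_mono_right (by omega)
  have hn' := lt_two_pow_log_add n
  have hg : 6 ≤ Nat.log 2 n := by
    have : Nat.log 2 64 ≤ Nat.log 2 n := Nat.log_mono_right (by omega)
    rwa [show (64 : ℕ) = 2 ^ 6 by norm_num, Nat.log_pow one_lt_two] at this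
  generalize Nat.log 2 n = g at *
  generalize Nat.log 2 F = f at *
  have hpow : n ^ k ≤ 2 ^ (2 * g * k) := by
    rw [pow_mul]
    exact Nat.pow_le_pow_left (hn'.le.trans (Nat.pow_le_pow_right two_pos (by omega))) k
  have h4 : 2 ^ (ℓ + (ℓ + f + 5)) + 4 ≤ 2 ^ (2 * ℓ + f + 6) := by
    have h5 : 2 ^ 2 ≤ 2 ^ (2 * ℓ + f + 5) := Nat.pow_le_pow_right two_pos (by omega)
    rw [show ℓ + (ℓ + f + 5) = 2 * ℓ + f + 5 by ring, pow_succ 2 (2 * ℓ + f + 5)]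
    omega
  have h6 : 2 * g * k + 2 * ℓ + f + g + 7 ≤ (2 * ℓ / g + 2) * ((2 * k + 4) * g) := by
    have h7 : 2 * ℓ < g * (2 * ℓ / g + 1) := Nat.lt_mul_div_succ _ (by omega)
    have h8 : g * (2 * ℓ / g + 1) ≤ (2 * k + 4) * (g * (2 * ℓ / g + 1)) :=
      Nat.le_mul_of_pos_left _ (by omega)
    have h9 : (2 * ℓ / g + 2) * ((2 * k + 4) * g) =
        (2 * k + 4) * (g * (2 * ℓ / g + 1)) + (2 * g * k + 4 * g) := by ring
    omega
  calc n ^ k * (2 ^ (ℓ + (ℓ + f + 5)) + 4) + n + 1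
      ≤ 2 ^ (2 * g * k) * 2 ^ (2 * ℓ + f + 6) + 2 ^ (g + 1) := by
        have := Nat.mul_le_mul hpow h4
        omega
    _ ≤ 2 ^ (2 * g * k + 2 * ℓ + f + g + 6) + 2 ^ (2 * g * k + 2 * ℓ + f + g + 6) := by
        rw [← pow_add]
        exact Nat.add_le_add (Nat.pow_le_pow_right two_pos (by omega))
          (Nat.pow_le_pow_right two_pos (by omega))
    _ = 2 ^ (2 * g * k + 2 * ℓ + f + g + 7) := by
        rw [pow_succ 2 (2 * g * k + 2 * ℓ + f + g + 6)]
        ring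
    _ ≤ _ := Nat.pow_le_pow_right two_pos h6

/-- Rounding down at most halves the logarithm, so the first factor is at most `4 * (ℓ / log n) +
2`; the second is at most `39 * F`, and `4 * 39 = 156`. -/
theorem rounds_le {n F ℓ : ℕ} (hF : 0 < F) (hn : 80 * F < n) :
    (((2 * ℓ / Nat.log 2 n + 2) * (36 * F + 3) : ℕ) : ℝ) ≤
      156 * (F + ℓ * F / Real.logb 2 n) := by
  have hn0 : n ≠ 0 := by omega
  have hg : 1 ≤ Nat.log 2 n := Nat.log_pos one_lt_two (by omega)
  have hg' : (1 : ℝ) ≤ Nat.log 2 n := by exact_mod_cast hg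
  have hlog_pos : 0 < Real.logb 2 n := Real.logb_pos one_lt_two (by exact_mod_cast (by omega : 1 < n))
  have hlog : Real.logb 2 n ≤ 2 * Nat.log 2 n := by
    have h1 : Real.logb 2 n ≤ Nat.log 2 n + 1 := by
      rw [Real.logb_le_iff_le_rpow one_lt_two (by positivity)]
      have := (lt_two_pow_log_add n).le
      rw [show ((Nat.log 2 n : ℝ) + 1) = ((Nat.log 2 n + 1 : ℕ) : ℝ) by push_cast; rfl,
        Real.rpow_natCast]
      exact_mod_cast this
    linarith
  have hdiv : ((2 * ℓ / Nat.log 2 n : ℕ) : ℝ) ≤ 4 * (ℓ / Real.logb 2 n) := by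
    calc ((2 * ℓ / Nat.log 2 n : ℕ) : ℝ) ≤ ((2 * ℓ : ℕ) : ℝ) / (Nat.log 2 n : ℕ) := Nat.cast_div_le
      _ = 4 * ℓ / (2 * Nat.log 2 n) := by
        push_cast
        field_simp
        ring
      _ ≤ 4 * ℓ / Real.logb 2 n := by gcongr
      _ = 4 * (ℓ / Real.logb 2 n) := by ring
  have hF' : (1 : ℝ) ≤ F := by exact_mod_cast hF
  have hnn : (0 : ℝ) ≤ ℓ / Real.logb 2 n := by positivity
  push_cast
  calc ((2 * ℓ / Nat.log 2 n : ℕ) + 2 : ℝ) * (36 * F + 3)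
      ≤ (4 * (ℓ / Real.logb 2 n) + 2) * (39 * F) := by
        gcongr
        linarith
    _ ≤ 156 * (F + ℓ * F / Real.logb 2 n) := by
        rw [mul_div_right_comm]
        nlinarith

theorem exists_scheme {n k F ℓ : ℕ} (hF : 0 < F) (hℓ : 0 < ℓ) (hn : 80 * F < n) :
    ∃ S : LabelingScheme ℓ (14 * ℓ + 3 * Nat.log 2 F) ((2 * k + 4) * Nat.log 2 n),
      S.IsResilient n k F ((2 * ℓ / Nat.log 2 n + 2) * (36 * F + 3)) := by
  classical
  let q := ℓ + Nat.log 2 F + 5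
  have hq : 12 * F ≤ 2 ^ q := by
    have h := lt_two_pow_log_add F
    have h' : 2 ^ (Nat.log 2 F + 1 + 4) ≤ 2 ^ q := Nat.pow_le_pow_right two_pos (by omega)
    rw [pow_add] at h'
    omega
  obtain ⟨emb⟩ : Nonempty (Label F ℓ q ↪ BitString (14 * ℓ + 3 * Nat.log 2 F)) := by
    apply Function.Embedding.nonempty_of_card_le
    rw [← Nat.card_eq_fintype_card]
    refine (card_label_le hF hℓ).trans ?_
    simp
  let x : ∀ i : ErasureInstance n k F ℓ, i.V → Option (BitString (14 * ℓ + 3 * Nat.log 2 F)) :=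
    fun i v => if v ∈ i.E then none else some (emb (@newLabel i.V i.finite i.N F ℓ q i.φ v))
  obtain ⟨A, hA⟩ := known_labels (b := (2 * k + 4) * Nat.log 2 n) (k := k) hF (by omega)
    (Nat.succ_pos _) (show ℓ ≤ q by omega) hq (capacity_le hF hn) x
    (fun o => o.map (Function.invFun emb))
    (fun i v hv => by simp [x, hv])
    (fun i v hv => by simp [x, hv, Function.leftInverse_invFun emb.injective _])
  -- The oracle must be defined on every type; its value on infinite ones is irrelevant.
  refine ⟨⟨fun V N φ v => if h : Finite V then emb (@newLabel V h N F ℓ q φ v) else fun _ => false,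
    A⟩, ?_⟩
  intro V _ _ N hV hid φ erased he v
  have hfin : Finite V := inferInstance
  have := hA ⟨V, hfin, N, by rw [Nat.card_eq_fintype_card, hV], hid, φ, erased, by
    rwa [Set.ncard_coe_finset]⟩ v
  refine Eq.trans ?_ this
  congr 1
  funext u
  by_cases hu : u ∈ erased
  · simp [x, hu]
  · simp [x, hu, hfin]

theorem theorem1 :
    ∃ (A : ℕ) (B : ℕ → ℕ) (C R : ℝ),
      (∀ F : ℕ, (B F : ℝ) ≤ C * Real.logb 2 F) ∧
      ∀ k : ℕ, ∃ β : ℕ, ∀ n F ℓ : ℕ, 80 * F < n →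
        ∃ T : ℕ, (T : ℝ) ≤ R * (F + ℓ * F / Real.logb 2 n) ∧
          ∃ S : LabelingScheme ℓ (A * ℓ + B F) (β * Nat.log 2 n), S.IsResilient n k F T := by
  refine ⟨14, fun F => 3 * Nat.log 2 F, 3, 156, fun F => ?_, fun k => ⟨2 * k + 4, ?_⟩⟩
  · push_cast
    have := Real.natLog_le_logb F 2
    push_cast at this
    linarith
  intro n F ℓ hn
  -- Empty labels need no communication; `card_label_le` requires `0 < ℓ`.
  rcases Nat.eq_zero_or_pos ℓ with rfl | hℓ
  · refine ⟨0, ?_, ⟨fun _ _ _ _ _ => false, ⟨Unit, fun _ _ _ => (), fun _ _ => [], fun s _ => s,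
      fun _ => Fin.elim0, by simp⟩⟩, ?_⟩
    · simp
    · intro V _ _ N _ _ φ erased _ v
      exact Subsingleton.elim _ _
  -- Without erasures the padded old label is enough, while group sizes around `2 * F` make sense
  -- only for `0 < F`.
  rcases Nat.eq_zero_or_pos F with rfl | hF
  · refine ⟨0, by simp, ⟨fun _ _ φ v i => if h : (i : ℕ) < ℓ then φ v ⟨i, h⟩ else false,
      ⟨Option (BitString (14 * ℓ + 3 * Nat.log 2 0)), fun _ _ y => y, fun _ _ => [],
        fun s _ => s, fun s i => (s.getD fun _ => false) ⟨i, by omega⟩, by simp⟩⟩, ?_⟩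
    intro V _ _ N _ _ φ erased he v
    have : erased = ∅ := Finset.card_eq_zero.1 (Nat.le_zero.1 he)
    subst this
    funext i
    simp [CongestAlgorithm.outputAfter, CongestAlgorithm.stateAfter]
  exact ⟨_, rounds_le hF hn, exists_scheme hF hℓ hn⟩
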